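/- Let $n\ge 2$ be a power of two, $d\ge 1$, $N=n^d$. For $x:[n]^d\to\mathbb C$ put $\widehat x_f=\sum_{t\in[n]^d}x_t e^{-2\pi i f^Tt/n}$. Let $\beta:[n]^d\to\mathbb C$ have exactly $k\ge 1$ nonzero values, and let $x$ be the worst-case $k$-sparse signal with random phase with values $\beta$: $\widehat x_f=\beta_f e^{i\theta_f}$, with $\theta_f$ ($f\in[n]^d$) independent and uniform on $[0,2\pi)$. Let $\Delta$ be a multiset of $s=C\,d^3\log_2^3 n$ independent uniform points of $[n]^d$, independent of $x$, where $C$ is an absolute constant. A node at level $l$ with label $\phi$ of the full binary tree of height $\log_2N$ has right and left children with labels $\phi$ and $\phi+2^l$; the root has label $0$. A label $\phi\in[N]$ is identified with the $f\in[n]^d$ for which $\phi=\sum_{q=1}^d f_q n^{q-1}$. The weight of a leaf $v$ of a subtree $T$ is the number of its ancestors having two children in $T$. For a leaf $v$ of $T$ with label $f$, the filter $G_{v,T}=G_1\times\cdots\times G_d$ on $[n]^d$ is defined by $$\widehat G_q(\xi)=\prod_j\tfrac12\left(1+e^{2\pi i(\xi-f_q)/2^j}\right),$$ over those $1\le j\le\log_2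 n$ for which the node at level $(q-1)\log_2 n+j-1$ on the path from the root to $v$ is a proper ancestor of $v$ with two children in $T$. The procedure SparseFFT-RandomPhase starts with $T=\{\text{root}\}$ and $\widehat\chi=0$, and repeats the following while $T\ne\emptyset$. It takes a leaf $v$ of minimal weight in $T$, with label $f$. 1. If $v$ has level $\log_2 N$: with $G=G_{v,T}$, it adds $N\sum_{j}x_jG_{-j}-\sum_{\xi}\widehat\chi_\xi\widehat G_\xi$ to $\widehat\chi_f$, and it removes from $T$ the leaf $v$ and the path up to its closest ancestor with two children (all of $T$ if there is none). 2. Otherwise, let $T'$ be $T$ with both children of $v$ added. For each child $w$ of $v$ it adds $w$ to $T$ if and only if, with $G=G_{w,T'}$, the sum $$\frac1{|\Delta|}\sum_{t\in\Delta}\Big|\sum_{j}G_{t-j}x_j-\frac1N\sum_{\xi}e^{2\pi i\xi^Tt/n}\widehat\chi_\xi\widehat G_\xi\Big|^2$$ is nonzero. When the loop ends it returns $\widehat\chi$. Samples of $x$ are counted with multiplicity. Time is counted in a unit-cost random access model with exact complex arithmetic, evaluation of $e^{2\pi i r}$ for real $r$, and operations on machine words holding elements of $[n]^d$ (including componentwise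 subtraction modulo $n$). **Theorem.** For every sufficiently large absolute constant $C$ there is a constant $A$ depending only on $C$ such that for all $n,d,k,\beta$ as above SparseFFT-RandomPhase halts and returns $\widehat x$ with probability at least $1-\frac1{N^2}$. Moreover, almost surely it halts after reading at most $A\,k^2\log_2^4N$ samples of $x$ and making at most $A\,k^2\log_2^4N$ elementary steps. -/

import Mathlib

/-! # Sparse Fourier transform of signals with random phase

Throughout `n = 2 ^ a` is a power of two, `d` is the dimension, and `N = n ^ d`. -/

namespace SFFT

/-! ## Signals and the Fourier transform -/

/-- The index set `[n]^d`, with componentwise arithmetic modulo `n = 2 ^ a`. -/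
abbrev Idx (a d : ℕ) := Fin d → ZMod (2 ^ a)

/-- `e^{2 π i r}`. -/
noncomputable def ex (r : ℝ) : ℂ := Complex.exp (2 * Real.pi * Complex.I * r)

/-- The inner product `fᵀ t` of the representatives in `{0, …, n - 1}`. -/
def dot {a d : ℕ} (f t : Idx a d) : ℕ := ∑ q, (f q).val * (t q).val

/-- The Fourier transform `x̂_f = ∑_t x_t e^{-2 π i fᵀt / n}`. -/
noncomputable def dft {a d : ℕ} (x : Idx a d → ℂ) (f : Idx a d) : ℂ :=
  ∑ t : Idx a d, x t * ex (-(dot f t : ℝ) / 2 ^ a)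

/-! ## The random objects -/

section Random
open MeasureTheory ProbabilityTheory

/-- `X` is a worst-case signal with random phase having values `β`: the phases `θ_f` are
independent and uniform on `[0, 2π)`, and `X̂_f = β_f e^{i θ_f}` for every frequency `f`. -/
def IsRandomPhaseSignal {Ω : Type*} [MeasurableSpace Ω] (P : Measure Ω) {a d : ℕ}
    (X : Ω → Idx a d → ℂ) (β : Idx a d → ℂ) : Prop :=
  ∃ θ : Idx a d → Ω → ℝ,
    (∀ f, Measurable (θ f)) ∧
    (∀ f, pdf.IsUniform (θ f) (Set.Ico 0 (2 * Real.pi)) P volume) ∧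
    iIndepFun θ P ∧
    ∀ ω f, dft (X ω) f = β f * Complex.exp (Complex.I * θ f ω)

/-- `Δ_1, …, Δ_s` are independent and uniform on `[n]^d`. -/
structure IsUniformSample {Ω : Type*} [MeasurableSpace Ω] (P : Measure Ω) {a d s : ℕ}
    (Δ : Fin s → Ω → Idx a d) : Prop where
  measurable : ∀ i, Measurable (Δ i)
  uniform : ∀ i, P.map (Δ i) = (PMF.uniformOfFintype (Idx a d)).toMeasure
  indep : iIndepFun Δ P

end Random

/-! ## Cost model

A unit-cost random access machine with exact complex arithmetic. A machine word holds a number of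
size polynomial in `N`, in particular an element of `[n]^d` (packed, `log₂ N` bits). One step is
charged for each of: an arithmetic operation, comparison or evaluation of `e^{2 π i r}` on
numbers; an arithmetic or comparison operation on words (including reading or writing one
coordinate of a packed index and componentwise subtraction of packed indices modulo the power of
two `n`, and shifts, in particular powers of two); reading or building one list or tree cell; one access to the signal. Inner products
`fᵀ t` are not unit cost: they are charged for every coordinate. The numbers
`n`, `d`, `N` are available, and the label of a leaf and its unflattening are the same word. The
signal is accessed only through `query`. -/

/-- The outcome of a computation: its result, the number of samples of the signal that it read, and
the number of elementary steps that it made. -/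
structure Run (α : Type) where
  val : α
  samples : ℕ
  steps : ℕ

instance : Monad Run where
  pure v := ⟨v, 0, 0⟩
  bind r g := ⟨(g r.val).val, r.samples + (g r.val).samples, r.steps + (g r.val).steps⟩

/-- Spend `c` steps. -/
def tick (c : ℕ) : Run Unit := ⟨(), 0, c⟩

/-- A value obtained with `c` elementary operations. -/
def charge {α : Type} (c : ℕ) (v : α) : Run α := ⟨v, 0, c⟩

/-- One access to the signal `x`. -/
def query {a d : ℕ} (x : Idx a d → ℂ) (t : Idx a d) : Run ℂ := ⟨x t, 1, 1⟩

/-! ## Subtrees of the full binary tree -/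

/-- A nonempty subtree (containing the root) of the full binary tree: a leaf, a node with a single
child (`left` tells which one), or a node with a right and a left child. -/
inductive SplitTree where
  | leaf : SplitTree
  | one (left : Bool) (t : SplitTree) : SplitTree
  | two (right left : SplitTree) : SplitTree

/-- A node, given by the path from the root; `true` means "go to the left child". -/
abbrev Path := List Bool

/-- The label and the level of a node. The right and the left child of a node with label `f` at
level `l` have labels `f` and `f + 2 ^ l`, so the path spells the label in binary, lowest bit
first. -/
def readLabel : Path → Run (ℕ × ℕ)
  | [] => charge 1 (0, 0)
  | b :: p => do
    let (f, l) ← readLabel p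
    charge 4 (2 * f + b.toNat, l + 1)

/-- The unflattening of a label in `[n ^ d]`: the element of `[n]^d` with coordinates
`⌊f / n ^ q⌋ mod n`. -/
def unflatten {a d : ℕ} (f : ℕ) : Idx a d := fun q => ((f / (2 ^ a) ^ (q : ℕ) : ℕ) : ZMod (2 ^ a))

/-- A leaf of minimal weight, together with its weight (the number of its ancestors that have two
children). -/
def minLeaf : SplitTree → Run (Path × ℕ)
  | .leaf => charge 1 ([], 0)
  | .one b t => do
    let (p, w) ← minLeaf t
    charge 2 (b :: p, w)
  | .two r l => do
    let (p, w) ← minLeaf r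
    let (p', w') ← minLeaf l
    if w ≤ w' then charge 4 (false :: p, w + 1) else charge 4 (true :: p', w' + 1)

/-- `Tree.remove`: delete the given leaf together with the path to its closest ancestor that has
two children; `none` is the empty tree. -/
def remove : SplitTree → Path → Run (Option SplitTree)
  | .leaf, _ => charge 1 none
  | .one b t, [] => charge 1 (some (.one b t))
  | .two r l, [] => charge 1 (some (.two r l))
  | .one b t, _ :: p => do
    let t' ← remove t p
    charge 2 (t'.map (.one b))
  | .two r l, true :: p => do
    match ← remove l p with
    | none => charge 2 (some (.one false r))
    | some l' => charge 2 (some (.two r l'))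
  | .two r l, false :: p => do
    match ← remove r p with
    | none => charge 2 (some (.one true l))
    | some r' => charge 2 (some (.two r' l))

/-- Replace the leaf at the end of the path by the tree `new`. -/
def graft (new : SplitTree) : SplitTree → Path → Run SplitTree
  | .leaf, _ => charge 1 new
  | .one b t, [] => charge 1 (.one b t)
  | .two r l, [] => charge 1 (.two r l)
  | .one b t, _ :: p => do
    let t' ← graft new t p
    charge 2 (.one b t')
  | .two r l, true :: p => do
    let l' ← graft new l p
    charge 2 (.two r l')
  | .two r l, false :: p => do
    let r' ← graft new r p
    charge 2 (.two r' l)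

/-! ## Adaptive aliasing filters -/

/-- `FilterPreProcess` for one coordinate. The tree is the part of the splitting tree below the
current node, the path leads from there to the leaf `v` to be isolated, `fq` is the current
coordinate of the label of `v`, and the levels `j, j + 1, …, j + m - 1` of this coordinate remain to
be treated. The entry for level `j` is `e^{-2 π i fq / 2^j}` if the current node has two children,
and `0` if it has one child or if `v` has been reached. Returned are these entries, and the subtree
and the path that remain for the next coordinate. -/
noncomputable def filterPreProcess (fq : ℕ) :
    (m j : ℕ) → SplitTree → Path → Run (List ℂ × SplitTree × Path)
  | 0, _, t, p => charge 1 ([], t, p)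
  | m + 1, j, .two r l, b :: p => do
    let (g, t', p') ← filterPreProcess fq m (j + 1) (if b then l else r) p
    charge 8 (ex (-(fq : ℝ) / 2 ^ j) :: g, t', p')
  | m + 1, j, .one _ t, _ :: p => do
    let (g, t', p') ← filterPreProcess fq m (j + 1) t p
    charge 4 (0 :: g, t', p')
  | m + 1, j, t, p => do
    let (g, t', p') ← filterPreProcess fq m (j + 1) t p
    charge 4 (0 :: g, t', p')

/-- `FilterPreProcess` for all coordinates in the list, for the leaf with label `f`. -/
noncomputable def filterPreProcessAll {a d : ℕ} (f : Idx a d) :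
    List (Fin d) → SplitTree → Path → Run (List (Fin d × List ℂ))
  | [], _, _ => charge 1 []
  | q :: qs, t, p => do
    let (g, t', p') ← filterPreProcess (f q).val a 1 t p
    let gs ← filterPreProcessAll f qs t' p'
    charge 3 ((q, g) :: gs)

/-- One update `G(t) ← G(t) / 2 + g · G(t + s) / 2`, for a filter given by the list of its support
points and values. -/
noncomputable def filterDouble {a : ℕ} (g : ℂ) (s : ZMod (2 ^ a)) :
    List (ZMod (2 ^ a) × ℂ) → Run (List (ZMod (2 ^ a) × ℂ))
  | [] => charge 1 []
  | (t, c) :: G => do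
    let G' ← filterDouble g s G
    charge 6 ((t, c / 2) :: (t - s, g * (c / 2)) :: G')

/-- The loop of `FilterTime`, from level `j` on, for a filter of length `n = 2 ^ a`; the shift at
level `j` is `n / 2 ^ j`. -/
noncomputable def filterTime {a : ℕ} :
    ℕ → List ℂ → List (ZMod (2 ^ a) × ℂ) → Run (List (ZMod (2 ^ a) × ℂ))
  | _, [], G => charge 1 G
  | j, g :: gs, G => do
    tick 4
    if g = 0 then filterTime (j + 1) gs G
    else
      let G' ← filterDouble g ((2 ^ a / 2 ^ j : ℕ) : ZMod (2 ^ a)) G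
      filterTime (j + 1) gs G'

/-- Multiply one term of a multidimensional filter with a filter in coordinate `q`, and put the
result in front of the list `acc`. -/
noncomputable def tensorTerm {a d : ℕ} (q : Fin d) (t : Idx a d) (c : ℂ) :
    List (ZMod (2 ^ a) × ℂ) → List (Idx a d × ℂ) → Run (List (Idx a d × ℂ))
  | [], acc => charge 1 acc
  | (u, e) :: G, acc => do
    let acc' ← tensorTerm q t c G acc
    charge 5 ((Function.update t q u, c * e) :: acc')

/-- Multiply a multidimensional filter with a filter in coordinate `q`. -/
noncomputable def tensor {a d : ℕ} (q : Fin d) (Gq : List (ZMod (2 ^ a) × ℂ)) :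
    List (Idx a d × ℂ) → Run (List (Idx a d × ℂ))
  | [] => charge 1 []
  | (t, c) :: G => do
    tick 2
    let acc ← tensor q Gq G
    tensorTerm q t c Gq acc

/-- The filter `G = G_1 × ⋯ × G_d` in time domain, as the list of its support points and values;
every `G_q` comes from `FilterTime`, started at the unit impulse. -/
noncomputable def filterTimeAll {a d : ℕ} :
    List (Fin d × List ℂ) → Run (List (Idx a d × ℂ))
  | [] => charge 1 [(0, 1)]
  | (q, g) :: gs => do
    let G ← filterTimeAll gs
    let Gq ← filterTime 1 g [((0 : ZMod (2 ^ a)), (1 : ℂ))]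
    tick 2
    tensor q Gq G

/-- `FilterFrequency`, from level `j` on: multiply `acc` by `(1 + g_j e^{2 π i ξ / 2^j}) / 2` for
all levels with `g_j ≠ 0`. -/
noncomputable def filterFrequency (ξ : ℕ) : ℕ → List ℂ → ℂ → Run ℂ
  | _, [], acc => charge 1 acc
  | j, g :: gs, acc => do
    tick 4
    if g = 0 then filterFrequency ξ (j + 1) gs acc
    else
      let acc' ← charge 7 (acc * ((1 + g * ex ((ξ : ℝ) / 2 ^ j)) / 2))
      filterFrequency ξ (j + 1) gs acc'

/-- `Ĝ(ξ) = ∏_q Ĝ_q(ξ_q)`. -/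
noncomputable def filterFrequencyAll {a d : ℕ} (ξ : Idx a d) : List (Fin d × List ℂ) → Run ℂ
  | [] => charge 1 1
  | (q, g) :: gs => do
    let y ← filterFrequencyAll ξ gs
    let z ← filterFrequency (ξ q).val 1 g 1
    charge 4 (y * z)

/-! ## The recovered part of the spectrum -/

/-- One recovered coefficient: the frequency `ξ`, the value `χ̂_ξ`, and the table of the numbers
`e^{2 π i ξᵀΔ / n}` for the sample points `Δ`. The table is computed once for every recovered
frequency. -/
structure Entry (a d : ℕ) where
  freq : Idx a d
  coef : ℂ
  row : List ℂ

/-- The signal `χ̂` that a list of entries stands for. -/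
noncomputable def spectrum {a d : ℕ} (chi : List (Entry a d)) (f : Idx a d) : ℂ :=
  (chi.map fun e => if e.freq = f then e.coef else 0).sum

/-- The table of the numbers `e^{2 π i ξᵀΔ / n}`, at `2 d` steps for each inner product. -/
noncomputable def phaseRow {a d : ℕ} (ξ : Idx a d) : List (Idx a d) → Run (List ℂ)
  | [] => charge 1 []
  | t :: ts => do
    let row ← phaseRow ξ ts
    tick (2 * d)
    charge 4 (ex ((dot ξ t : ℝ) / 2 ^ a) :: row)

/-- The update `χ̂_f ← χ̂_f + z`. -/
noncomputable def addCoef {a d : ℕ} (Δs : List (Idx a d)) (f : Idx a d) (z : ℂ) :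
    List (Entry a d) → Run (List (Entry a d))
  | [] => do
    let row ← phaseRow f Δs
    charge 3 [⟨f, z, row⟩]
  | e :: es => do
    tick 2
    if e.freq = f then charge 3 (⟨e.freq, e.coef + z, e.row⟩ :: es)
    else
      let es' ← addCoef Δs f z es
      charge 1 (e :: es')

/-! ## The algorithm -/

/-- The sum `∑_j G(t - j) x_j`, from the list of the support points `p = t - j` of `G`. -/
noncomputable def filteredSample {a d : ℕ} (x : Idx a d → ℂ) (t : Idx a d) :
    List (Idx a d × ℂ) → Run ℂ
  | [] => charge 1 0
  | (p, c) :: G => do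
    let y ← filteredSample x t G
    let z ← query x (t - p)
    charge 4 (c * z + y)

/-- `∑_ξ χ̂_ξ Ĝ(ξ)`. -/
noncomputable def filteredSpectrum {a d : ℕ} (gs : List (Fin d × List ℂ)) :
    List (Entry a d) → Run ℂ
  | [] => charge 1 0
  | e :: es => do
    let y ← filteredSpectrum gs es
    let z ← filterFrequencyAll e.freq gs
    charge 4 (e.coef * z + y)

/-- Add `w` times a row of phases to a vector indexed by the sample points. -/
noncomputable def addRow (w : ℂ) : List ℂ → List ℂ → Run (List ℂ)
  | z :: row, h :: hs => do
    let hs' ← addRow w row hs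
    charge 5 ((w * z + h) :: hs')
  | _, _ => charge 1 []

/-- The vector of zeros indexed by the sample points. -/
noncomputable def zeroRow {a d : ℕ} : List (Idx a d) → Run (List ℂ)
  | [] => charge 1 []
  | _ :: ts => do
    let hs ← zeroRow ts
    charge 2 (0 :: hs)

/-- The vector of the sums `∑_ξ e^{2 π i ξᵀΔ / n} χ̂_ξ Ĝ(ξ)`, for all sample points `Δ`. -/
noncomputable def spectrumAtSamples {a d : ℕ} (gs : List (Fin d × List ℂ))
    (Δs : List (Idx a d)) : List (Entry a d) → Run (List ℂ)
  | [] => zeroRow Δs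
  | e :: es => do
    let hs ← spectrumAtSamples gs Δs es
    let z ← filterFrequencyAll e.freq gs
    let w ← charge 3 (e.coef * z)
    addRow w e.row hs

/-- `∑_Δ |H^Δ|²`, where `H^Δ = ∑_j G(Δ - j) x_j - h^Δ` and `h^Δ = (1 / N)` times the entry of the
given vector. -/
noncomputable def energy {a d : ℕ} (x : Idx a d → ℂ) (G : List (Idx a d × ℂ)) :
    List (Idx a d) → List ℂ → Run ℝ
  | t :: ts, h :: hs => do
    let E ← energy x G ts hs
    let y ← filteredSample x t G
    charge 7 (Complex.normSq (y - 1 / ((2 ^ a) ^ d : ℂ) * h) + E)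
  | _, _ => charge 1 0

/-- `ZeroTest`: is the residual signal nonzero on the frequency cone of the leaf `v` of `T`? -/
noncomputable def zeroTest {a d : ℕ} (x : Idx a d → ℂ) (chi : List (Entry a d)) (T : SplitTree)
    (v : Path) (Δs : List (Idx a d)) : Run Bool := do
  let (f, _) ← readLabel v
  let gs ← filterPreProcessAll (unflatten f : Idx a d) (List.finRange d) T v
  let G ← filterTimeAll gs
  let hs ← spectrumAtSamples gs Δs chi
  let E ← energy x G Δs hs
  tick (Δs.length + 3)
  if 1 / (Δs.length : ℝ) * E = 0 then pure false else pure true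

/-- Estimation of the residual at the frequency of the leaf `v`, and removal of `v`. -/
noncomputable def estimateLeaf {a d : ℕ} (x : Idx a d → ℂ) (Δs : List (Idx a d)) (T : SplitTree)
    (chi : List (Entry a d)) (v : Path) : Run (Option SplitTree × List (Entry a d)) := do
  let (f, _) ← readLabel v
  let gs ← filterPreProcessAll (unflatten f : Idx a d) (List.finRange d) T v
  let G ← filterTimeAll gs
  let h ← filteredSpectrum gs chi
  let y ← filteredSample x 0 G
  let z ← charge 3 (((2 ^ a) ^ d : ℂ) * y - h)
  let chi' ← addCoef Δs (unflatten f) z chi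
  let T' ← remove T v
  pure (T', chi')

/-- Exploration of the two children of the leaf `v`. -/
noncomputable def expandLeaf {a d : ℕ} (x : Idx a d → ℂ) (Δs : List (Idx a d)) (T : SplitTree)
    (chi : List (Entry a d)) (v : Path) : Run (Option SplitTree × List (Entry a d)) := do
  let T' ← graft (.two .leaf .leaf) T v
  tick (2 * v.length + 2)
  let right ← zeroTest x chi T' (v ++ [false]) Δs
  let left ← zeroTest x chi T' (v ++ [true]) Δs
  tick 2
  let Tnew ← match right, left with
    | true, true => graft (.two .leaf .leaf) T v
    | true, false => graft (.one false .leaf) T v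
    | false, true => graft (.one true .leaf) T v
    | false, false => charge 1 T
  pure (some Tnew, chi)

/-- One iteration of the main loop, on a nonempty tree. -/
noncomputable def iteration {a d : ℕ} (x : Idx a d → ℂ) (Δs : List (Idx a d)) (T : SplitTree)
    (chi : List (Entry a d)) : Run (Option SplitTree × List (Entry a d)) := do
  let (v, _) ← minLeaf T
  let (_, l) ← readLabel v
  tick 2
  if l = d * a then estimateLeaf x Δs T chi v else expandLeaf x Δs T chi v

/-- The main loop, `while T ≠ ∅`. The value is `none` if the loop has not ended after `m` checks of
the loop condition. -/
noncomputable def mainLoop {a d : ℕ} (x : Idx a d → ℂ) (Δs : List (Idx a d)) :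
    ℕ → Option SplitTree → List (Entry a d) → Option (Run (List (Entry a d)))
  | 0, _, _ => none
  | _ + 1, none, chi => some (charge 1 chi)
  | m + 1, some T, chi =>
    let r := iteration x Δs T chi
    (mainLoop x Δs m r.val.1 r.val.2).map fun r' =>
      ⟨r'.val, r.samples + r'.samples, r.steps + r'.steps + 1⟩

/-- The number `|Δ| = C d³ log₂³ n` of sample points. -/
def sampleCount (C a d : ℕ) : ℕ := C * d ^ 3 * a ^ 3

/-- `SparseFFT-RandomPhase`, with the random sample points `Δ`, halts on the signal `x` and `r` is
its outcome: the returned list of coefficients, the number of samples, and the number of steps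
(including `d + 1` steps for drawing each sample point). The loop starts with the tree that
consists of the root, and with `χ̂ = 0`. -/
def SparseFFTRandomPhase {a d s : ℕ} (x : Idx a d → ℂ) (Δ : Fin s → Idx a d)
    (r : Run (List (Entry a d))) : Prop :=
  ∃ m r', mainLoop x (List.ofFn Δ) m (some .leaf) [] = some r' ∧
    r = ⟨r'.val, r'.samples, r'.steps + s * (d + 1) + 1⟩

end SFFT

namespace SFFT

/-! ## Characters and Fourier inversion -/

/-! The phases enter through one event of full probability. For every nonempty set `S` of
frequencies in the support of `β` and every point `t`, the sum over `S` of the terms `x̂_f e^{2πi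
fᵀt/n}` is nonzero. Indeed, with all phases but one fixed, it vanishes for at most countably many
values of the remaining phase, so independence and Fubini give a null set (`ae_phase_sum_ne_zero`),
and there are only finitely many pairs `(S, t)` (`ae_generic`). Everything else is deterministic on
this event, so the failure event is null and the resource bounds hold almost surely.

A filter built from the branching nodes above a leaf `v` has response `1` on the frequencies below
`v` and `0` on those below any other leaf: at a shared branch its factor is `1`, and at the branch
where two paths separate it is `(1 - 1)/2` (`response_filterPreProcess`, `isolation`). If the leaves
cover all unrecovered frequencies and the other coefficients are correct, then a filtered residual
sample is `1/N` times the partial sum over the unrecovered frequencies below `v` (`residual_sum`).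
By genericity a single sample point already decides whether there are any (`zeroTest_iff`); at full
depth the sum has one term, which is the missing coefficient (`estimateLeaf_inv`).

The loop invariant `LoopInv` says that the leaves are exactly the ancestors of the unrecovered
frequencies at certain depths. Every iteration deepens some frequency or recovers one, so there are
at most `k (log₂ N + 1)` iterations. A leaf of minimal weight `w` satisfies `2^w ≤` number of leaves
`≤ k` (`two_pow_minLeaf_le`), so its filter has at most `k` support points, and at most `2k` for a
child. With `s` sample points an iteration thus costs `O(k s)`, apart from the phase tables, which
are paid once per recovered frequency. Since `s = C (log₂ N)³`, the total is `O(k² log₂⁴ N)`. -/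

lemma ex_add (r s : ℝ) : ex (r + s) = ex r * ex s := by
  simp only [ex]; rw [← Complex.exp_add]; push_cast; ring_nf

@[simp] lemma ex_zero : ex 0 = 1 := by simp [ex]

lemma ex_int (m : ℤ) : ex (m : ℝ) = 1 := by
  simp only [ex]
  rw [← Complex.exp_int_mul_two_pi_mul_I m]; push_cast; ring_nf

lemma ex_half : ex (1 / 2) = -1 := by
  simp only [ex]
  rw [← Complex.exp_pi_mul_I]; push_cast; ring_nf

lemma ex_ne_zero (r : ℝ) : ex r ≠ 0 := Complex.exp_ne_zero _

lemma ex_sum {ι : Type*} (s : Finset ι) (r : ι → ℝ) : ex (∑ i ∈ s, r i) = ∏ i ∈ s, ex (r i) := by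
  classical
  induction s using Finset.induction_on with
  | empty => simp
  | insert i s hi ih => rw [Finset.sum_insert hi, Finset.prod_insert hi, ex_add, ih]

/-- The standard additive character of `ℤ / 2 ^ a`. -/
noncomputable abbrev std (a : ℕ) : AddChar (ZMod (2 ^ a)) ℂ := ZMod.stdAddChar

lemma std_natCast (a m : ℕ) : std a (m : ZMod (2 ^ a)) = ex ((m : ℝ) / 2 ^ a) := by
  have h := ZMod.stdAddChar_coe (N := 2 ^ a) (m : ℤ)
  push_cast at h
  rw [std, h, ex]
  push_cast
  ring_nf

/-- The character `t ↦ e^{2 π i fᵀ t / n}`. -/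
noncomputable def chr {a d : ℕ} (f t : Idx a d) : ℂ := ∏ q, std a (f q * t q)

lemma ex_dot {a d : ℕ} (f t : Idx a d) : ex ((dot f t : ℝ) / 2 ^ a) = chr f t := by
  rw [dot, Nat.cast_sum, Finset.sum_div, ex_sum, chr]
  refine Finset.prod_congr rfl fun q _ => ?_
  rw [← std_natCast]
  simp

lemma chr_add {a d : ℕ} (f t u : Idx a d) : chr f (t + u) = chr f t * chr f u := by
  simp [chr, mul_add, AddChar.map_add_eq_mul, Finset.prod_mul_distrib]

@[simp] lemma chr_zero {a d : ℕ} (f : Idx a d) : chr f 0 = 1 := by simp [chr]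

lemma chr_single {a d : ℕ} (f : Idx a d) (q : Fin d) (u : ZMod (2 ^ a)) :
    chr f (Pi.single q u) = std a (f q * u) := by
  rw [chr, Finset.prod_eq_single q]
  · simp
  · intro b _ hb; simp [hb]
  · simp

/-- The numbers `-(dot f t)` and `dot f (-t)` agree only modulo `n`, because `dot` uses
representatives. Both sides are inverse to the same nonzero phase, so that phase is cancelled. -/
lemma ex_neg_dot {a d : ℕ} (f t : Idx a d) : ex (-(dot f t : ℝ) / 2 ^ a) = chr f (-t) := by
  have h : ex (-(dot f t : ℝ) / 2 ^ a) * ex ((dot f t : ℝ) / 2 ^ a) = chr f (-t) * chr f t := by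
    rw [← ex_add, ← chr_add]; simp [neg_div]
  rw [ex_dot] at h
  refine mul_right_cancel₀ ?_ h
  rw [← ex_dot]; exact ex_ne_zero _

/-- The sum factors over the coordinates, and in each of them it is the orthogonality relation of
the primitive character. -/
lemma sum_chr {a d : ℕ} (u : Idx a d) :
    ∑ f : Idx a d, chr f u = if u = 0 then ((2 ^ a) ^ d : ℂ) else 0 := by
  have h1 : ∑ f : Idx a d, chr f u = ∏ q, ∑ z : ZMod (2 ^ a), std a (z * u q) := by
    rw [Finset.prod_univ_sum]; simp [chr]
  rw [h1]
  have h2 : ∀ q, ∑ z : ZMod (2 ^ a), std a (z * u q) = if u q = 0 then (2 ^ a : ℂ) else 0 := by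
    intro q
    have := AddChar.sum_mulShift (u q) (ZMod.isPrimitive_stdAddChar (2 ^ a))
    rw [this, ZMod.card]; push_cast; rfl
  simp only [h2]
  by_cases hu : u = 0
  · simp [hu]
  · obtain ⟨q, hq⟩ := Function.ne_iff.mp hu
    rw [if_neg hu]
    exact Finset.prod_eq_zero (Finset.mem_univ q) (if_neg hq)

lemma pow_card_ne_zero (a d : ℕ) : ((2 ^ a) ^ d : ℂ) ≠ 0 :=
  pow_ne_zero _ (pow_ne_zero _ two_ne_zero)

lemma fourier_inversion {a d : ℕ} (x : Idx a d → ℂ) (t : Idx a d) :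
    ∑ f, dft x f * chr f t = ((2 ^ a) ^ d : ℂ) * x t := by
  simp only [dft, ex_neg_dot, Finset.sum_mul]
  rw [Finset.sum_comm]
  have : ∀ u : Idx a d, ∑ f, x u * chr f (-u) * chr f t
      = if t = u then ((2 ^ a) ^ d : ℂ) * x u else 0 := by
    intro u
    have h := sum_chr (-u + t)
    simp only [chr_add] at h
    simp only [mul_assoc, ← Finset.mul_sum, h]
    by_cases htu : t = u
    · simp [htu, mul_comm]
    · rw [if_neg htu, if_neg, mul_zero]
      intro h0
      exact htu (neg_add_eq_zero.mp h0).symm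
  simp [this]

/-! ## Results and costs of computations -/

@[simp] lemma Run.val_bind {α β : Type} (r : Run α) (g : α → Run β) :
    (r >>= g).val = (g r.val).val := rfl
@[simp] lemma Run.samples_bind {α β : Type} (r : Run α) (g : α → Run β) :
    (r >>= g).samples = r.samples + (g r.val).samples := rfl
@[simp] lemma Run.steps_bind {α β : Type} (r : Run α) (g : α → Run β) :
    (r >>= g).steps = r.steps + (g r.val).steps := rfl
@[simp] lemma val_charge {α : Type} (c : ℕ) (v : α) : (charge c v).val = v := rfl
@[simp] lemma samples_charge {α : Type} (c : ℕ) (v : α) : (charge c v).samples = 0 := rfl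
@[simp] lemma steps_charge {α : Type} (c : ℕ) (v : α) : (charge c v).steps = c := rfl
@[simp] lemma samples_tick (c : ℕ) : (tick c).samples = 0 := rfl
@[simp] lemma steps_tick (c : ℕ) : (tick c).steps = c := rfl
@[simp] lemma val_query {a d : ℕ} (x : Idx a d → ℂ) (t : Idx a d) : (query x t).val = x t := rfl
@[simp] lemma samples_query {a d : ℕ} (x : Idx a d → ℂ) (t : Idx a d) :
    (query x t).samples = 1 := rfl
@[simp] lemma steps_query {a d : ℕ} (x : Idx a d → ℂ) (t : Idx a d) : (query x t).steps = 1 := rfl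

/-! ## Filters in time domain -/

/-- The number of nonzero entries. -/
noncomputable def nonzeros (g : List ℂ) : ℕ := g.countP (· ≠ 0)

/-- The frequency response of the part of a one-dimensional filter given by the levels from `j`
on. -/
noncomputable def response (z : ℕ) : ℕ → List ℂ → ℂ
  | _, [] => 1
  | j, g :: gs => (if g = 0 then 1 else (1 + g * ex ((z : ℝ) / 2 ^ j)) / 2) * response z (j + 1) gs

lemma nonzeros_cons_zero (gs : List ℂ) : nonzeros (0 :: gs) = nonzeros gs := by
  simp [nonzeros]

lemma nonzeros_cons_ne {g : ℂ} (hg : g ≠ 0) (gs : List ℂ) :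
    nonzeros (g :: gs) = nonzeros gs + 1 := by
  simp [nonzeros, hg]

lemma filterFrequency_val (z : ℕ) (gs : List ℂ) (j : ℕ) (acc : ℂ) :
    (filterFrequency z j gs acc).val = acc * response z j gs := by
  induction gs generalizing j acc with
  | nil => simp [filterFrequency, response]
  | cons g gs ih =>
    by_cases hg : g = 0
    · simp [filterFrequency, response, hg, ih]
    · simp [filterFrequency, response, hg, ih]; ring

lemma filterFrequency_samples (z : ℕ) (gs : List ℂ) (j : ℕ) (acc : ℂ) :
    (filterFrequency z j gs acc).samples = 0 := by
  induction gs generalizing j acc with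
  | nil => simp [filterFrequency]
  | cons g gs ih => by_cases hg : g = 0 <;> simp [filterFrequency, hg, ih]

lemma filterFrequency_steps (z : ℕ) (gs : List ℂ) (j : ℕ) (acc : ℂ) :
    (filterFrequency z j gs acc).steps ≤ 11 * gs.length + 1 := by
  induction gs generalizing j acc with
  | nil => simp [filterFrequency]
  | cons g gs ih =>
    by_cases hg : g = 0
    · have := ih (j + 1) acc
      simp [filterFrequency, hg]; omega
    · have := ih (j + 1) (acc * ((1 + g * ex ((z : ℝ) / 2 ^ j)) / 2))
      simp [filterFrequency, hg]; omega

/-- The frequency response at `z` of a one-dimensional filter given by its support points and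
values. -/
noncomputable def transform1 {a : ℕ} (G : List (ZMod (2 ^ a) × ℂ)) (z : ZMod (2 ^ a)) : ℂ :=
  (G.map fun p => p.2 * std a (-(z * p.1))).sum

/-- Moving a support point from `t` to `t - s` multiplies its contribution by the character value at
`z * s`. -/
lemma transform1_filterDouble {a : ℕ} (g : ℂ) (s z : ZMod (2 ^ a)) (G : List (ZMod (2 ^ a) × ℂ)) :
    transform1 (filterDouble g s G).val z = transform1 G z * ((1 + g * std a (z * s)) / 2) := by
  induction G with
  | nil => simp [filterDouble, transform1]
  | cons p G ih =>
    obtain ⟨t, c⟩ := p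
    simp only [transform1] at ih
    have h : std a (-(z * (t - s))) = std a (-(z * t)) * std a (z * s) := by
      rw [← AddChar.map_add_eq_mul]; congr 1; ring
    simp only [filterDouble, Run.val_bind, val_charge, transform1, List.map_cons, List.sum_cons, ih,
      h]
    ring

lemma length_filterDouble {a : ℕ} (g : ℂ) (s : ZMod (2 ^ a)) (G : List (ZMod (2 ^ a) × ℂ)) :
    (filterDouble g s G).val.length = 2 * G.length := by
  induction G with
  | nil => simp [filterDouble]
  | cons p G ih => simp [filterDouble, ih]; ring

lemma filterDouble_samples {a : ℕ} (g : ℂ) (s : ZMod (2 ^ a)) (G : List (ZMod (2 ^ a) × ℂ)) :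
    (filterDouble g s G).samples = 0 := by
  induction G with
  | nil => simp [filterDouble]
  | cons p G ih => simp [filterDouble, ih]

lemma filterDouble_steps {a : ℕ} (g : ℂ) (s : ZMod (2 ^ a)) (G : List (ZMod (2 ^ a) × ℂ)) :
    (filterDouble g s G).steps = 6 * G.length + 1 := by
  induction G with
  | nil => simp [filterDouble]
  | cons p G ih => simp [filterDouble, ih]; ring

/-- For `j ≤ a` the division `2 ^ a / 2 ^ j` is exact, so a shift by `n / 2^j` produces precisely
the phase used by the frequency-domain formula. -/
lemma std_mul_shift {a j : ℕ} (hj : j ≤ a) (z : ZMod (2 ^ a)) :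
    std a (z * ((2 ^ a / 2 ^ j : ℕ) : ZMod (2 ^ a))) = ex ((z.val : ℝ) / 2 ^ j) := by
  have h : z * ((2 ^ a / 2 ^ j : ℕ) : ZMod (2 ^ a))
      = ((z.val * 2 ^ (a - j) : ℕ) : ZMod (2 ^ a)) := by
    rw [Nat.pow_div hj (by norm_num), Nat.cast_mul, ZMod.natCast_zmod_val]
  rw [h, std_natCast]
  congr 1
  have : (2 : ℝ) ^ a = 2 ^ (a - j) * 2 ^ j := by rw [← pow_add]; congr 1; omega
  rw [this]; push_cast; field_simp

lemma transform1_filterTime {a : ℕ} (z : ZMod (2 ^ a)) (gs : List ℂ) (j : ℕ)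
    (hj : j + gs.length ≤ a + 1) (G : List (ZMod (2 ^ a) × ℂ)) :
    transform1 (filterTime j gs G).val z = transform1 G z * response z.val j gs := by
  induction gs generalizing j G with
  | nil => simp [filterTime, response]
  | cons g gs ih =>
    simp only [List.length_cons] at hj
    have ih' := fun G => ih (j + 1) (by omega) G
    by_cases hg : g = 0
    · simp [filterTime, response, hg, ih']
    · simp only [filterTime, hg, response, if_false, Run.val_bind, ih', transform1_filterDouble,
        std_mul_shift (show j ≤ a by omega)]
      ring

/-- Each nonzero entry doubles the list. Coinciding support points are not merged, so the length is
exact. -/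
lemma length_filterTime {a : ℕ} (gs : List ℂ) (j : ℕ) (G : List (ZMod (2 ^ a) × ℂ)) :
    (filterTime j gs G).val.length = G.length * 2 ^ nonzeros gs := by
  induction gs generalizing j G with
  | nil => simp [filterTime, nonzeros]
  | cons g gs ih =>
    by_cases hg : g = 0
    · subst hg; simp [filterTime, nonzeros_cons_zero, ih]
    · simp [filterTime, hg, nonzeros_cons_ne hg, ih, length_filterDouble]; ring

lemma filterTime_samples {a : ℕ} (gs : List ℂ) (j : ℕ) (G : List (ZMod (2 ^ a) × ℂ)) :
    (filterTime j gs G).samples = 0 := by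
  induction gs generalizing j G with
  | nil => simp [filterTime]
  | cons g gs ih => by_cases hg : g = 0 <;> simp [filterTime, hg, ih, filterDouble_samples]

lemma filterTime_steps {a : ℕ} (gs : List ℂ) (j : ℕ) (G : List (ZMod (2 ^ a) × ℂ)) :
    (filterTime j gs G).steps ≤ gs.length * (6 * (G.length * 2 ^ nonzeros gs) + 5) + 1 := by
  induction gs generalizing j G with
  | nil => simp [filterTime]
  | cons g gs ih =>
    by_cases hg : g = 0
    · subst hg
      have := ih (j + 1) G
      simp only [filterTime, if_true, Run.steps_bind, steps_tick, nonzeros_cons_zero,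
        List.length_cons, add_mul]
      omega
    · have := ih (j + 1) (filterDouble g ((2 ^ a / 2 ^ j : ℕ) : ZMod (2 ^ a)) G).val
      simp only [filterTime, hg, if_false, Run.steps_bind, steps_tick, nonzeros_cons_ne hg,
        List.length_cons, add_mul, filterDouble_steps]
      rw [length_filterDouble] at this
      have h2 : 2 * G.length * 2 ^ nonzeros gs = G.length * 2 ^ (nonzeros gs + 1) := by ring
      rw [h2] at this
      -- Every intermediate list is no longer than the final one, so each level can be charged the
      -- final length.
      have h3 : G.length ≤ G.length * 2 ^ (nonzeros gs + 1) :=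
        Nat.le_mul_of_pos_right _ (by positivity)
      omega

/-! ### Multidimensional filters as tensor products -/

/-- The frequency response at `ξ` of a filter given by its support points and values. -/
noncomputable def transform {a d : ℕ} (G : List (Idx a d × ℂ)) (ξ : Idx a d) : ℂ :=
  (G.map fun p => p.2 * chr ξ (-p.1)).sum

lemma tensorTerm_val {a d : ℕ} (q : Fin d) (t : Idx a d) (c : ℂ) (Gq : List (ZMod (2 ^ a) × ℂ))
    (acc : List (Idx a d × ℂ)) :
    (tensorTerm q t c Gq acc).val
      = (Gq.map fun p => (Function.update t q p.1, c * p.2)) ++ acc := by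
  induction Gq with
  | nil => simp [tensorTerm]
  | cons p Gq ih => simp [tensorTerm, ih]

lemma tensorTerm_samples {a d : ℕ} (q : Fin d) (t : Idx a d) (c : ℂ)
    (Gq : List (ZMod (2 ^ a) × ℂ)) (acc : List (Idx a d × ℂ)) :
    (tensorTerm q t c Gq acc).samples = 0 := by
  induction Gq with
  | nil => simp [tensorTerm]
  | cons p Gq ih => simp [tensorTerm, ih]

lemma tensorTerm_steps {a d : ℕ} (q : Fin d) (t : Idx a d) (c : ℂ)
    (Gq : List (ZMod (2 ^ a) × ℂ)) (acc : List (Idx a d × ℂ)) :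
    (tensorTerm q t c Gq acc).steps = 5 * Gq.length + 1 := by
  induction Gq with
  | nil => simp [tensorTerm]
  | cons p Gq ih => simp [tensorTerm, ih]; ring

lemma tensor_val {a d : ℕ} (q : Fin d) (Gq : List (ZMod (2 ^ a) × ℂ)) (G : List (Idx a d × ℂ)) :
    (tensor q Gq G).val
      = G.flatMap fun r => Gq.map fun p => (Function.update r.1 q p.1, r.2 * p.2) := by
  induction G with
  | nil => simp [tensor]
  | cons r G ih => simp [tensor, ih, tensorTerm_val]

lemma tensor_samples {a d : ℕ} (q : Fin d) (Gq : List (ZMod (2 ^ a) × ℂ))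
    (G : List (Idx a d × ℂ)) : (tensor q Gq G).samples = 0 := by
  induction G with
  | nil => simp [tensor]
  | cons r G ih => simp [tensor, ih, tensorTerm_samples]

lemma tensor_steps {a d : ℕ} (q : Fin d) (Gq : List (ZMod (2 ^ a) × ℂ))
    (G : List (Idx a d × ℂ)) : (tensor q Gq G).steps = G.length * (5 * Gq.length + 3) + 1 := by
  induction G with
  | nil => simp [tensor]
  | cons r G ih => simp [tensor, ih, tensorTerm_steps]; ring

lemma length_tensor {a d : ℕ} (q : Fin d) (Gq : List (ZMod (2 ^ a) × ℂ))
    (G : List (Idx a d × ℂ)) : (tensor q Gq G).val.length = G.length * Gq.length := by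
  rw [tensor_val]
  induction G with
  | nil => simp
  | cons r G ih => simp [ih]; ring

/-- Tensoring overwrites coordinate `q`. When that coordinate was zero, this is a translation by a
vector supported in `q`, and the character splits into two factors. -/
lemma transform_tensor {a d : ℕ} (q : Fin d) (Gq : List (ZMod (2 ^ a) × ℂ))
    (G : List (Idx a d × ℂ)) (hG : ∀ r ∈ G, r.1 q = 0) (ξ : Idx a d) :
    transform (tensor q Gq G).val ξ = transform G ξ * transform1 Gq (ξ q) := by
  rw [tensor_val]
  induction G with
  | nil => simp [transform]
  | cons r G ih =>
    have ih' := ih fun r hr => hG r (List.mem_cons_of_mem _ hr)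
    have h0 : r.1 q = 0 := hG r List.mem_cons_self
    have hterm : (Gq.map fun p : ZMod (2 ^ a) × ℂ =>
        r.2 * p.2 * chr ξ (-(Function.update r.1 q p.1))).sum
        = r.2 * chr ξ (-r.1) * transform1 Gq (ξ q) := by
      rw [transform1, ← List.sum_map_mul_left]
      congr 1
      refine List.map_congr_left fun p _ => ?_
      have hu : -(Function.update r.1 q p.1) = -r.1 + Pi.single q (-p.1) := by
        ext i
        by_cases hi : i = q
        · subst hi; simp [h0]
        · simp [hi]
      rw [hu, chr_add, chr_single, mul_neg]; ring
    simp only [transform] at ih' ⊢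
    simp only [List.flatMap_cons, List.map_append, List.sum_append, List.map_map, List.map_cons,
      List.sum_cons, add_mul, ih', Function.comp_def, hterm]

/-- The total number of nonzero entries. -/
noncomputable def totalNonzeros {d : ℕ} (gs : List (Fin d × List ℂ)) : ℕ :=
  (gs.map fun p => nonzeros p.2).sum

/-- The frequency response of a multidimensional filter. -/
noncomputable def totalResponse {a d : ℕ} (ξ : Idx a d) (gs : List (Fin d × List ℂ)) : ℂ :=
  (gs.map fun p => response (ξ p.1).val 1 p.2).prod

/-- Supplies the vanishing condition of `transform_tensor`: a coordinate not yet processed keeps its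
value from the unit impulse. -/
lemma filterTimeAll_coord_eq_zero {a d : ℕ} (gs : List (Fin d × List ℂ)) (q : Fin d)
    (hq : q ∉ gs.map Prod.fst) : ∀ r ∈ (filterTimeAll (a := a) gs).val, r.1 q = 0 := by
  induction gs with
  | nil => simp [filterTimeAll]
  | cons p gs ih =>
    obtain ⟨q', g⟩ := p
    simp only [List.map_cons, List.mem_cons, not_or] at hq
    intro r hr
    simp only [filterTimeAll, Run.val_bind, tensor_val, List.mem_flatMap, List.mem_map] at hr
    obtain ⟨r', hr', p, _, rfl⟩ := hr
    simp [hq.1, ih hq.2 r' hr']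

lemma transform_filterTimeAll {a d : ℕ} (ξ : Idx a d) (gs : List (Fin d × List ℂ))
    (hnd : (gs.map Prod.fst).Nodup) (hlen : ∀ p ∈ gs, p.2.length = a) :
    transform (filterTimeAll (a := a) gs).val ξ = totalResponse ξ gs := by
  induction gs with
  | nil => simp [filterTimeAll, transform, totalResponse]
  | cons p gs ih =>
    obtain ⟨q, g⟩ := p
    simp only [List.map_cons, List.nodup_cons] at hnd
    have ih' := ih hnd.2 fun p hp => hlen p (List.mem_cons_of_mem _ hp)
    have hl : g.length = a := hlen (q, g) List.mem_cons_self
    have h1 : transform1 [((0 : ZMod (2 ^ a)), (1 : ℂ))] (ξ q) = 1 := by simp [transform1]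
    simp only [filterTimeAll, Run.val_bind]
    rw [transform_tensor _ _ _ (filterTimeAll_coord_eq_zero gs q hnd.1), ih',
      transform1_filterTime _ _ _ (by omega), h1]
    simp only [totalResponse, List.map_cons, List.prod_cons]
    ring

lemma length_filterTimeAll {a d : ℕ} (gs : List (Fin d × List ℂ)) :
    (filterTimeAll (a := a) gs).val.length = 2 ^ totalNonzeros gs := by
  induction gs with
  | nil => simp [filterTimeAll, totalNonzeros]
  | cons p gs ih =>
    simp only [filterTimeAll, Run.val_bind, length_tensor, ih, length_filterTime, totalNonzeros,
      List.map_cons, List.sum_cons, pow_add, List.length_cons, List.length_nil]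
    ring

lemma filterTimeAll_samples {a d : ℕ} (gs : List (Fin d × List ℂ)) :
    (filterTimeAll (a := a) gs).samples = 0 := by
  induction gs with
  | nil => simp [filterTimeAll]
  | cons p gs ih => simp [filterTimeAll, ih, filterTime_samples, tensor_samples]

lemma filterTimeAll_steps {a d : ℕ} (gs : List (Fin d × List ℂ))
    (hlen : ∀ p ∈ gs, p.2.length = a) :
    (filterTimeAll (a := a) gs).steps
      ≤ gs.length * ((11 * a + 12) * 2 ^ totalNonzeros gs) + 1 := by
  induction gs with
  | nil => simp [filterTimeAll]
  | cons p gs ih =>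
    obtain ⟨q, g⟩ := p
    have ih' := ih fun p hp => hlen p (List.mem_cons_of_mem _ hp)
    have hl : g.length = a := hlen (q, g) List.mem_cons_self
    have ht : totalNonzeros ((q, g) :: gs) = nonzeros g + totalNonzeros gs := by
      simp [totalNonzeros]
    have hft := filterTime_steps (a := a) g 1 [((0 : ZMod (2 ^ a)), (1 : ℂ))]
    simp only [filterTimeAll, Run.steps_bind, steps_tick, tensor_steps, length_filterTimeAll,
      length_filterTime, ht, pow_add, List.length_cons, List.length_nil]
    rw [hl] at hft
    simp only [List.length_cons, List.length_nil, zero_add, one_mul] at hft ⊢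
    have hu : 1 ≤ 2 ^ nonzeros g := Nat.one_le_two_pow
    have hv : 1 ≤ 2 ^ totalNonzeros gs := Nat.one_le_two_pow
    generalize 2 ^ nonzeros g = u at *
    generalize 2 ^ totalNonzeros gs = v at *
    have e1 : gs.length * ((11 * a + 12) * v) ≤ gs.length * ((11 * a + 12) * (u * v)) := by
      gcongr; exact Nat.le_mul_of_pos_left _ hu
    have e2 : a * (6 * u + 5) ≤ 11 * a * (u * v) := by
      have : 6 * u + 5 ≤ 11 * (u * v) := by nlinarith
      calc a * (6 * u + 5) ≤ a * (11 * (u * v)) := by gcongr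
        _ = _ := by ring
    have e3 : v * (5 * u + 3) + 4 ≤ 12 * (u * v) := by nlinarith
    calc _ ≤ gs.length * ((11 * a + 12) * (u * v)) + 1 + (11 * a * (u * v) + 1 + (2 +
          (v * (5 * u + 3) + 1))) := by omega
      _ ≤ _ := by
        have : (gs.length + 1) * ((11 * a + 12) * (u * v))
          = gs.length * ((11 * a + 12) * (u * v)) + 11 * a * (u * v) + 12 * (u * v) := by ring
        omega

/-! ### Evaluation of filters in frequency domain -/

lemma filterFrequencyAll_val {a d : ℕ} (ξ : Idx a d) (gs : List (Fin d × List ℂ)) :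
    (filterFrequencyAll ξ gs).val = totalResponse ξ gs := by
  induction gs with
  | nil => simp [filterFrequencyAll, totalResponse]
  | cons p gs ih =>
    simp only [filterFrequencyAll, Run.val_bind, val_charge, ih, filterFrequency_val,
      totalResponse, List.map_cons, List.prod_cons]
    ring

lemma filterFrequencyAll_samples {a d : ℕ} (ξ : Idx a d) (gs : List (Fin d × List ℂ)) :
    (filterFrequencyAll ξ gs).samples = 0 := by
  induction gs with
  | nil => simp [filterFrequencyAll]
  | cons p gs ih => simp [filterFrequencyAll, ih, filterFrequency_samples]

lemma filterFrequencyAll_steps {a d : ℕ} (ξ : Idx a d) (gs : List (Fin d × List ℂ))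
    (hlen : ∀ p ∈ gs, p.2.length = a) :
    (filterFrequencyAll ξ gs).steps ≤ gs.length * (11 * a + 5) + 1 := by
  induction gs with
  | nil => simp [filterFrequencyAll]
  | cons p gs ih =>
    obtain ⟨q, g⟩ := p
    have ih' := ih fun p hp => hlen p (List.mem_cons_of_mem _ hp)
    have hl : g.length = a := hlen (q, g) List.mem_cons_self
    have h := filterFrequency_steps (ξ q).val g 1 1
    rw [hl] at h
    simp only [filterFrequencyAll, Run.steps_bind, steps_charge, List.length_cons, add_mul]
    omega

/-! ## Labels and bits -/

/-- The bits `i, …, i + m - 1` of `z`. -/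
def bitsFrom (z i m : ℕ) : List Bool := List.ofFn fun j : Fin m => z.testBit (i + j)

@[simp] lemma bitsFrom_zero (z i : ℕ) : bitsFrom z i 0 = [] := by simp [bitsFrom]

lemma bitsFrom_succ (z i m : ℕ) : bitsFrom z i (m + 1) = z.testBit i :: bitsFrom z (i + 1) m := by
  simp [bitsFrom, List.ofFn_succ, Nat.add_assoc, Nat.add_comm 1]

/-- The bits of the given coordinates of `ξ`. -/
def bitsOf {a d : ℕ} (ξ : Idx a d) (qs : List (Fin d)) : List Bool :=
  qs.flatMap fun q => bitsFrom (ξ q).val 0 a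

/-- The path from the root to the leaf of the full tree with label `ξ`. -/
def bits {a d : ℕ} (ξ : Idx a d) : List Bool := bitsOf ξ (List.finRange d)

lemma mul_add_lt {a d : ℕ} (i : Fin d) (j : Fin a) : (i : ℕ) * a + j < d * a :=
  calc (i : ℕ) * a + j < i * a + a := by omega
    _ = (i + 1) * a := by ring
    _ ≤ d * a := Nat.mul_le_mul_right _ i.2

lemma pos_of_fin_mul {a d : ℕ} (k : Fin (d * a)) : 0 < a := by
  rcases Nat.eq_zero_or_pos a with h | h
  · subst h; exact absurd k.2 (by simp)
  · exact h

/-- Position `k` on a root-to-leaf path is bit `k % a` of coordinate `k / a`; this makes the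
flattening of labels accessible to computation. -/
lemma bits_eq {a d : ℕ} (ξ : Idx a d) :
    bits ξ = List.ofFn fun k : Fin (d * a) =>
      (ξ ⟨k / a, Nat.div_lt_of_lt_mul (k.2.trans_eq (mul_comm d a))⟩).val.testBit (k % a) := by
  rw [List.ofFn_mul, bits, bitsOf, List.flatMap, ← List.ofFn_eq_map]
  congr 2
  funext i
  rw [bitsFrom]
  congr 1
  funext j
  have ha : 0 < a := lt_of_le_of_lt (Nat.zero_le _) j.2
  have h1 : ((i : ℕ) * a + j) / a = i := by
    rw [mul_comm, Nat.mul_add_div ha, Nat.div_eq_of_lt j.2, add_zero]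
  have h2 : ((i : ℕ) * a + j) % a = j := by
    rw [mul_comm, Nat.mul_add_mod, Nat.mod_eq_of_lt j.2]
  simp only [zero_add, h1, h2]

@[simp] lemma length_bits {a d : ℕ} (ξ : Idx a d) : (bits ξ).length = d * a := by
  simp [bits_eq]

lemma bits_injective {a d : ℕ} : Function.Injective (bits : Idx a d → List Bool) := by
  intro ξ η h
  rw [bits_eq, bits_eq] at h
  have h' := List.ofFn_injective h
  funext q
  apply ZMod.val_injective
  apply Nat.eq_of_testBit_eq
  intro j
  by_cases hj : j < a
  · have h1 := congrFun h' ⟨q * a + j, mul_add_lt q ⟨j, hj⟩⟩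
    have ha : 0 < a := lt_of_le_of_lt (Nat.zero_le _) hj
    have e1 : ((q : ℕ) * a + j) / a = q := by
      rw [mul_comm, Nat.mul_add_div ha, Nat.div_eq_of_lt hj, add_zero]
    have e2 : ((q : ℕ) * a + j) % a = j := by
      rw [mul_comm, Nat.mul_add_mod, Nat.mod_eq_of_lt hj]
    simpa only [e1, e2] using h1
  -- Beyond the first `a` bits there is nothing to compare, since representatives are below `2 ^ a`.
  · have hle : 2 ^ a ≤ 2 ^ j := Nat.pow_le_pow_right (by norm_num) (by omega)
    rw [Nat.testBit_lt_two_pow (lt_of_lt_of_le (ZMod.val_lt _) hle),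
      Nat.testBit_lt_two_pow (lt_of_lt_of_le (ZMod.val_lt _) hle)]

lemma readLabel_testBit (p : Path) (i : ℕ) :
    (readLabel p).val.1.testBit i = p.getD i false := by
  induction p generalizing i with
  | nil => simp [readLabel]
  | cons b p ih =>
    have h : (readLabel (b :: p)).val.1 = 2 * (readLabel p).val.1 + b.toNat := rfl
    rw [h]
    cases i with
    | zero => cases b <;> simp
    | succ i =>
      rw [Nat.testBit_succ]
      have : (2 * (readLabel p).val.1 + b.toNat) / 2 = (readLabel p).val.1 := by
        cases b <;> simp; omega
      rw [this, ih]; simp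

lemma readLabel_level (p : Path) : (readLabel p).val.2 = p.length := by
  induction p with
  | nil => rfl
  | cons b p ih =>
    have h : (readLabel (b :: p)).val.2 = (readLabel p).val.2 + 1 := rfl
    rw [h, ih]; rfl

lemma readLabel_samples (p : Path) : (readLabel p).samples = 0 := by
  induction p with
  | nil => rfl
  | cons b p ih =>
    have h : (readLabel (b :: p)).samples = (readLabel p).samples + 0 := rfl
    rw [h, ih]

lemma readLabel_steps (p : Path) : (readLabel p).steps = 4 * p.length + 1 := by
  induction p with
  | nil => rfl
  | cons b p ih =>
    have h : (readLabel (b :: p)).steps = (readLabel p).steps + 4 := rfl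
    rw [h, ih, List.length_cons]; ring

/-- The element of `[n]^d` that is the label of the node `v`. -/
def label (a d : ℕ) (v : Path) : Idx a d := unflatten (readLabel v).val.1

/-- The label of an inner node is its path padded with zero bits (the default `false` of `getD`),
that is, the label of the rightmost leaf below it. -/
lemma prefix_bits_label {a d : ℕ} (v : Path) (hv : v.length ≤ d * a) :
    v <+: bits (label a d v) := by
  rw [List.prefix_iff_eq_take]
  refine List.ext_getElem (by simpa using hv) fun i h1 h2 => ?_
  have hi : i < d * a := lt_of_lt_of_le h1 hv
  have ha : 0 < a := pos_of_fin_mul ⟨i, hi⟩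
  rw [List.getElem_take]
  simp only [bits_eq, List.getElem_ofFn, label, unflatten, ZMod.val_natCast]
  rw [Nat.testBit_mod_two_pow, ← pow_mul, Nat.testBit_div_two_pow, readLabel_testBit]
  have hm : i % a < a := Nat.mod_lt _ ha
  have : i % a + a * (i / a) = i := Nat.mod_add_div i a
  simp [hm, this, List.getElem?_eq_getElem h1]

lemma bits_label {a d : ℕ} (v : Path) (hv : v.length = d * a) : bits (label a d v) = v :=
  ((prefix_bits_label v hv.le).eq_of_length (by simp [hv])).symm

/-! ## Leaves of splitting trees -/

/-- The path `p` leads to a leaf of the tree. -/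
def IsLeaf : SplitTree → Path → Prop
  | .leaf, p => p = []
  | .one _ _, [] => False
  | .one b t, c :: p => c = b ∧ IsLeaf t p
  | .two _ _, [] => False
  | .two _ l, true :: p => IsLeaf l p
  | .two r _, false :: p => IsLeaf r p

lemma isLeaf_two_cons (r l : SplitTree) (c : Bool) (p : Path) :
    IsLeaf (.two r l) (c :: p) ↔ IsLeaf (if c then l else r) p := by
  cases c <;> simp [IsLeaf]

/-- The weight of a leaf. -/
def weight : SplitTree → Path → ℕ
  | .one _ t, _ :: p => weight t p
  | .two _ l, true :: p => weight l p + 1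
  | .two r _, false :: p => weight r p + 1
  | _, _ => 0

lemma weight_two_cons (r l : SplitTree) (c : Bool) (p : Path) :
    weight (.two r l) (c :: p) = weight (if c then l else r) p + 1 := by
  cases c <;> simp [weight]

/-- The paths to all leaves. -/
def leaves : SplitTree → List Path
  | .leaf => [[]]
  | .one b t => (leaves t).map (b :: ·)
  | .two r l => (leaves r).map (false :: ·) ++ (leaves l).map (true :: ·)

lemma mem_leaves (T : SplitTree) (p : Path) : p ∈ leaves T ↔ IsLeaf T p := by
  induction T generalizing p with
  | leaf => simp [leaves, IsLeaf]
  | one b t ih =>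
    cases p with
    | nil => simp [leaves, IsLeaf]
    | cons c p => simp [leaves, IsLeaf, ih, and_comm, eq_comm]
  | two r l ihr ihl =>
    rcases p with _ | ⟨_ | _, p⟩ <;> simp [leaves, IsLeaf, ihr, ihl]

lemma nodup_leaves (T : SplitTree) : (leaves T).Nodup := by
  induction T with
  | leaf => simp [leaves]
  | one b t ih => exact ih.map fun _ _ h => (List.cons.inj h).2
  | two r l ihr ihl =>
    refine List.Nodup.append (ihr.map fun _ _ h => (List.cons.inj h).2)
      (ihl.map fun _ _ h => (List.cons.inj h).2) ?_
    intro p h1 h2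
    simp only [List.mem_map] at h1 h2
    obtain ⟨_, _, rfl⟩ := h1
    obtain ⟨_, _, h⟩ := h2
    simp at h

lemma length_leaves_pos (T : SplitTree) : 0 < (leaves T).length := by
  induction T with
  | leaf => simp [leaves]
  | one b t ih => simpa [leaves] using ih
  | two r l ihr ihl => simp only [leaves, List.length_append, List.length_map]; omega

/-- Used with `R` the unrecovered frequencies: every leaf is the ancestor of one of them. -/
lemma length_leaves_le_card {ι : Type*} (T : SplitTree) (R : Finset ι) (loc : ι → Path)
    (h : ∀ p, IsLeaf T p → ∃ ξ ∈ R, p = loc ξ) : (leaves T).length ≤ R.card := by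
  classical
  rw [← List.toFinset_card_of_nodup (nodup_leaves T)]
  refine (Finset.card_le_card fun p hp => ?_).trans (Finset.card_image_le (s := R) (f := loc))
  rw [List.mem_toFinset, mem_leaves] at hp
  obtain ⟨ξ, hξ, rfl⟩ := h p hp
  exact Finset.mem_image_of_mem _ hξ

/-! ### Leaves of minimal weight -/

lemma minLeaf_one_val (b : Bool) (t : SplitTree) :
    (minLeaf (.one b t)).val = (b :: (minLeaf t).val.1, (minLeaf t).val.2) := rfl

lemma minLeaf_two_val (r l : SplitTree) : (minLeaf (.two r l)).val =
    if (minLeaf r).val.2 ≤ (minLeaf l).val.2 then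
      (false :: (minLeaf r).val.1, (minLeaf r).val.2 + 1)
    else (true :: (minLeaf l).val.1, (minLeaf l).val.2 + 1) := by
  change (if (minLeaf r).val.2 ≤ (minLeaf l).val.2 then
    charge 4 (false :: (minLeaf r).val.1, (minLeaf r).val.2 + 1)
    else charge 4 (true :: (minLeaf l).val.1, (minLeaf l).val.2 + 1)).val = _
  split_ifs <;> rfl

lemma isLeaf_minLeaf (T : SplitTree) : IsLeaf T (minLeaf T).val.1 := by
  induction T with
  | leaf => rfl
  | one b t ih => rw [minLeaf_one_val]; exact ⟨rfl, ih⟩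
  | two r l ihr ihl => rw [minLeaf_two_val]; split_ifs <;> assumption

lemma minLeaf_weight (T : SplitTree) : (minLeaf T).val.2 = weight T (minLeaf T).val.1 := by
  induction T with
  | leaf => rfl
  | one b t ih => rw [minLeaf_one_val]; exact ih
  | two r l ihr ihl => rw [minLeaf_two_val]; split_ifs <;> simp [weight, ihr, ihl]

/-- A Kraft-type inequality: below a branching node both subtrees have at least `2 ^ m` leaves,
where `m` is the smaller of their minimal weights, so together they have at least `2 ^ (m + 1)`.
This is what bounds the support of the filters. -/
lemma two_pow_minLeaf_le (T : SplitTree) : 2 ^ (minLeaf T).val.2 ≤ (leaves T).length := by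
  induction T with
  | leaf => simp [minLeaf, leaves]
  | one b t ih => rw [minLeaf_one_val]; simpa [leaves] using ih
  | two r l ihr ihl =>
    rw [minLeaf_two_val]
    simp only [leaves, List.length_append, List.length_map]
    split_ifs with h
    · have := Nat.pow_le_pow_right (show 0 < 2 by norm_num) h
      simp only [pow_succ]; omega
    · have := Nat.pow_le_pow_right (show 0 < 2 by norm_num) (Nat.le_of_not_le h)
      simp only [pow_succ]; omega

lemma minLeaf_samples (T : SplitTree) : (minLeaf T).samples = 0 := by
  induction T with
  | leaf => rfl
  | one b t ih =>
    have h : (minLeaf (.one b t)).samples = (minLeaf t).samples + 0 := rfl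
    rw [h, ih]
  | two r l ihr ihl =>
    have h : (minLeaf (.two r l)).samples = (minLeaf r).samples + ((minLeaf l).samples +
      (if (minLeaf r).val.2 ≤ (minLeaf l).val.2 then
        charge 4 (false :: (minLeaf r).val.1, (minLeaf r).val.2 + 1)
        else charge 4 (true :: (minLeaf l).val.1, (minLeaf l).val.2 + 1)).samples) := rfl
    rw [h, ihr, ihl]; split_ifs <;> rfl

/-- Passing to a parent raises the height by one and hence gives each leaf four more steps, which
pays for the work at that parent. -/
lemma minLeaf_steps (T : SplitTree) (h : ℕ) (hT : ∀ p, IsLeaf T p → p.length ≤ h) :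
    (minLeaf T).steps ≤ (leaves T).length * (4 * (h + 1)) := by
  induction T generalizing h with
  | leaf => simp [minLeaf, leaves]; omega
  | one b t ih =>
    obtain ⟨p, hp⟩ : ∃ p, IsLeaf t p := ⟨_, isLeaf_minLeaf t⟩
    have h0 := hT (b :: p) ⟨rfl, hp⟩
    obtain ⟨h, rfl⟩ : ∃ h', h = h' + 1 := ⟨h - 1, by simp at h0; omega⟩
    have ih' := ih h fun p hp => by
      have := hT (b :: p) ⟨rfl, hp⟩
      simpa using this
    have hs : (minLeaf (.one b t)).steps = (minLeaf t).steps + 2 := rfl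
    have := length_leaves_pos t
    simp only [leaves, List.length_map, hs]
    have e : (leaves t).length * (4 * (h + 1 + 1)) = (leaves t).length * (4 * (h + 1)) +
      4 * (leaves t).length := by ring
    omega
  | two r l ihr ihl =>
    have h0 := hT (false :: _) (show IsLeaf (.two r l) _ from isLeaf_minLeaf r)
    obtain ⟨h, rfl⟩ : ∃ h', h = h' + 1 := ⟨h - 1, by simp at h0; omega⟩
    have ihr' := ihr h fun p hp => by
      have := hT (false :: p) hp
      simpa using this
    have ihl' := ihl h fun p hp => by
      have := hT (true :: p) hp
      simpa using this
    have hs : (minLeaf (.two r l)).steps = (minLeaf r).steps + ((minLeaf l).steps +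
      (if (minLeaf r).val.2 ≤ (minLeaf l).val.2 then
        charge 4 (false :: (minLeaf r).val.1, (minLeaf r).val.2 + 1)
        else charge 4 (true :: (minLeaf l).val.1, (minLeaf l).val.2 + 1)).steps) := rfl
    have hs' : (minLeaf (.two r l)).steps = (minLeaf r).steps + ((minLeaf l).steps + 4) := by
      rw [hs]; split_ifs <;> rfl
    have := length_leaves_pos r
    simp only [leaves, List.length_append, List.length_map, hs']
    have e : ((leaves r).length + (leaves l).length) * (4 * (h + 1 + 1))
      = (leaves r).length * (4 * (h + 1)) + (leaves l).length * (4 * (h + 1)) +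
        (4 * (leaves r).length + 4 * (leaves l).length) := by ring
    omega

/-! ## Modifications of splitting trees -/

lemma isLeaf_graft (new T : SplitTree) (v : Path) (hv : IsLeaf T v) (p : Path) :
    IsLeaf (graft new T v).val p ↔
      (IsLeaf T p ∧ p ≠ v) ∨ ∃ p', p = v ++ p' ∧ IsLeaf new p' := by
  induction T generalizing v p with
  | leaf =>
    have hv' : v = [] := hv
    subst hv'
    simp only [graft, val_charge, IsLeaf, List.nil_append]
    constructor
    · exact fun h => Or.inr ⟨p, rfl, h⟩
    · rintro (⟨h, h'⟩ | ⟨p', rfl, h⟩)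
      · exact absurd h h'
      · exact h
  | one b t ih =>
    rcases v with _ | ⟨c, v⟩
    · exact absurd hv (by simp [IsLeaf])
    obtain ⟨rfl, hv⟩ := hv
    rcases p with _ | ⟨e, p⟩
    · simp [graft, IsLeaf]
    · simp only [graft, Run.val_bind, val_charge, IsLeaf, ih v hv, List.cons_append,
        List.cons.injEq, ne_eq]
      by_cases he : e = c <;> simp [he]
  | two r l ihr ihl =>
    rcases v with _ | ⟨c, v⟩
    · exact absurd hv (by simp [IsLeaf])
    rcases p with _ | ⟨e, p⟩
    · cases c <;> simp [graft, IsLeaf]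
    · cases c <;> cases e <;> simp only [IsLeaf] at hv <;>
        simp [graft, IsLeaf, ihl v, ihr v, hv]

lemma graft_samples (new T : SplitTree) (v : Path) : (graft new T v).samples = 0 := by
  induction T generalizing v with
  | leaf => simp [graft]
  | one b t ih => cases v <;> simp [graft, ih]
  | two r l ihr ihl => rcases v with _ | ⟨_ | _, v⟩ <;> simp [graft, ihr, ihl]

lemma graft_steps (new T : SplitTree) (v : Path) :
    (graft new T v).steps ≤ 2 * v.length + 1 := by
  induction T generalizing v with
  | leaf => simp [graft]
  | one b t ih =>
    rcases v with _ | ⟨c, v⟩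
    · simp [graft]
    · have := ih v
      simp [graft]; omega
  | two r l ihr ihl =>
    rcases v with _ | ⟨_ | _, v⟩
    · simp [graft]
    · have := ihr v
      simp [graft]; omega
    · have := ihl v
      simp [graft]; omega

lemma weight_graft_two (T : SplitTree) (v : Path) (hv : IsLeaf T v) (b : Bool) :
    weight (graft (.two .leaf .leaf) T v).val (v ++ [b]) = weight T v + 1 := by
  induction T generalizing v with
  | leaf =>
    have hv' : v = [] := hv
    subst hv'
    cases b <;> simp [graft, weight]
  | one c t ih =>
    rcases v with _ | ⟨c, v⟩
    · exact absurd hv (by simp [IsLeaf])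
    simp [graft, weight, ih v hv.2]
  | two r l ihr ihl =>
    rcases v with _ | ⟨_ | _, v⟩
    · exact absurd hv (by simp [IsLeaf])
    · simp [graft, weight, ihr v hv]
    · simp [graft, weight, ihl v hv]

lemma remove_two_true (r l : SplitTree) (p : Path) :
    (remove (.two r l) (true :: p)).val =
      match (remove l p).val with
      | none => some (.one false r)
      | some l' => some (.two r l') := by
  simp only [remove, Run.val_bind]
  cases (remove l p).val <;> rfl

lemma remove_two_false (r l : SplitTree) (p : Path) :
    (remove (.two r l) (false :: p)).val =
      match (remove r p).val with
      | none => some (.one true l)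
      | some r' => some (.two r' l) := by
  simp only [remove, Run.val_bind]
  cases (remove r p).val <;> rfl

/-- The leaves of a possibly empty tree. -/
def IsLeafOpt (T : Option SplitTree) (p : Path) : Prop := ∃ t, T = some t ∧ IsLeaf t p

/-- Deleting the path up to the closest branching ancestor turns no inner node into a leaf: that
ancestor keeps its other child. -/
lemma isLeaf_remove (T : SplitTree) (v : Path) (hv : IsLeaf T v) (p : Path) :
    IsLeafOpt (remove T v).val p ↔ IsLeaf T p ∧ p ≠ v := by
  induction T generalizing v p with
  | leaf =>
    have hv' : v = [] := hv
    subst hv'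
    simp [remove, IsLeaf, IsLeafOpt]
  | one b t ih =>
    rcases v with _ | ⟨c, v⟩
    · exact absurd hv (by simp [IsLeaf])
    obtain ⟨rfl, hv⟩ := hv
    have ih' := ih v hv
    simp only [remove, Run.val_bind, val_charge]
    cases h : (remove t v).val with
    | none =>
      simp only [h, IsLeafOpt] at ih'
      rcases p with _ | ⟨e, p⟩
      · simp [IsLeafOpt, IsLeaf]
      · have := ih' p
        simp [IsLeafOpt, IsLeaf] at this ⊢; tauto
    | some t' =>
      simp only [h, IsLeafOpt] at ih'
      rcases p with _ | ⟨e, p⟩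
      · simp [IsLeafOpt, IsLeaf]
      · have := ih' p
        simp [IsLeafOpt, IsLeaf] at this ⊢; tauto
  | two r l ihr ihl =>
    rcases v with _ | ⟨_ | _, v⟩
    · exact absurd hv (by simp [IsLeaf])
    · have ih' := ihr v hv
      rw [remove_two_false]
      cases h : (remove r v).val with
      | none =>
        simp only [h, IsLeafOpt] at ih'
        rcases p with _ | ⟨_ | _, p⟩
        · simp [IsLeafOpt, IsLeaf]
        · have := ih' p
          simp [IsLeafOpt, IsLeaf] at this ⊢; tauto
        · simp [IsLeafOpt, IsLeaf]
      | some t' =>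
        simp only [h, IsLeafOpt] at ih'
        rcases p with _ | ⟨_ | _, p⟩
        · simp [IsLeafOpt, IsLeaf]
        · have := ih' p
          simp [IsLeafOpt, IsLeaf] at this ⊢; tauto
        · simp [IsLeafOpt, IsLeaf]
    · have ih' := ihl v hv
      rw [remove_two_true]
      cases h : (remove l v).val with
      | none =>
        simp only [h, IsLeafOpt] at ih'
        rcases p with _ | ⟨_ | _, p⟩
        · simp [IsLeafOpt, IsLeaf]
        · simp [IsLeafOpt, IsLeaf]
        · have := ih' p
          simp [IsLeafOpt, IsLeaf] at this ⊢; tauto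
      | some t' =>
        simp only [h, IsLeafOpt] at ih'
        rcases p with _ | ⟨_ | _, p⟩
        · simp [IsLeafOpt, IsLeaf]
        · simp [IsLeafOpt, IsLeaf]
        · have := ih' p
          simp [IsLeafOpt, IsLeaf] at this ⊢; tauto

lemma remove_cost (T : SplitTree) (v : Path) :
    (remove T v).samples = 0 ∧ (remove T v).steps ≤ 2 * v.length + 1 := by
  induction T generalizing v with
  | leaf => simp [remove]
  | one b t ih =>
    rcases v with _ | ⟨c, v⟩
    · simp [remove]
    · have := ih v
      simp [remove]; omega
  | two r l ihr ihl =>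
    rcases v with _ | ⟨_ | _, v⟩
    · simp [remove]
    · have := ihr v
      simp only [remove, Run.samples_bind, Run.steps_bind]
      cases (remove r v).val <;> simp <;> omega
    · have := ihl v
      simp only [remove, Run.samples_bind, Run.steps_bind]
      cases (remove l v).val <;> simp <;> omega

/-! ## Isolation -/

lemma filterPreProcess_two (f m j : ℕ) (r l : SplitTree) (b : Bool) (p : Path) :
    (filterPreProcess f (m + 1) j (.two r l) (b :: p)).val
      = (ex (-(f : ℝ) / 2 ^ j) :: (filterPreProcess f m (j + 1) (if b then l else r) p).val.1,
        (filterPreProcess f m (j + 1) (if b then l else r) p).val.2) := rfl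

lemma filterPreProcess_one (f m j : ℕ) (b c : Bool) (t : SplitTree) (p : Path) :
    (filterPreProcess f (m + 1) j (.one b t) (c :: p)).val
      = (0 :: (filterPreProcess f m (j + 1) t p).val.1,
        (filterPreProcess f m (j + 1) t p).val.2) := rfl

lemma filterPreProcess_leaf (f m j : ℕ) (p : Path) :
    (filterPreProcess f (m + 1) j .leaf p).val
      = (0 :: (filterPreProcess f m (j + 1) .leaf p).val.1,
        (filterPreProcess f m (j + 1) .leaf p).val.2) := by
  cases p <;> rfl

lemma filterPreProcess_cost (f m j : ℕ) (t : SplitTree) (p : Path) :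
    (filterPreProcess f m j t p).samples = 0 ∧
      (filterPreProcess f m j t p).steps ≤ 8 * m + 1 := by
  induction m generalizing j t p with
  | zero => simp [filterPreProcess]
  | succ m ih =>
    rcases t with _ | ⟨b, t⟩ | ⟨r, l⟩
    · have := ih (j + 1) .leaf p
      cases p <;> simp [filterPreProcess] <;> omega
    · rcases p with _ | ⟨c, p⟩
      · have := ih (j + 1) (.one b t) []
        simp [filterPreProcess]; omega
      · have := ih (j + 1) t p
        simp [filterPreProcess]; omega
    · rcases p with _ | ⟨c, p⟩
      · have := ih (j + 1) (.two r l) []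
        simp [filterPreProcess]; omega
      · have := ih (j + 1) (if c then l else r) p
        simp [filterPreProcess]; omega

/-- Bookkeeping for passing from one coordinate to the next: nonzero entries written so far and
weight still ahead add up to the weight of the leaf. -/
lemma filterPreProcess_leaf_rest (f m j : ℕ) (t : SplitTree) (p : Path) (hp : IsLeaf t p) :
    let r := (filterPreProcess f m j t p).val
    IsLeaf r.2.1 r.2.2 ∧ r.2.2 = p.drop m ∧ r.1.length = m ∧
      nonzeros r.1 + weight r.2.1 r.2.2 = weight t p := by
  induction m generalizing j t p with
  | zero => simpa [filterPreProcess, nonzeros] using hp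
  | succ m ih =>
    rcases t with _ | ⟨b, t⟩ | ⟨r, l⟩
    · have hp' : p = [] := hp
      subst hp'
      have := ih (j + 1) .leaf [] hp
      rw [filterPreProcess_leaf]
      simpa [nonzeros_cons_zero] using this
    · rcases p with _ | ⟨c, p⟩
      · exact absurd hp (by simp [IsLeaf])
      have := ih (j + 1) t p hp.2
      rw [filterPreProcess_one]
      simpa [nonzeros_cons_zero, weight] using this
    · rcases p with _ | ⟨c, p⟩
      · exact absurd hp (by simp [IsLeaf])
      rw [isLeaf_two_cons] at hp
      have := ih (j + 1) _ p hp
      rw [filterPreProcess_two, weight_two_cons]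
      simp only [nonzeros_cons_ne (ex_ne_zero _), List.length_cons, List.drop_succ_cons] at this ⊢
      refine ⟨this.1, this.2.1, ?_, ?_⟩ <;> omega

/-! ### The filter factors along a path -/

lemma ex_quotient_of_mod_eq {f z i : ℕ} (h : f % 2 ^ i = z % 2 ^ i) :
    ex (-(f : ℝ) / 2 ^ i) * ex ((z : ℝ) / 2 ^ i) = 1 := by
  rw [← ex_add]
  obtain ⟨c, hc⟩ := (Nat.modEq_iff_dvd.mp h : ((2 ^ i : ℕ) : ℤ) ∣ z - f)
  have hc' : (z : ℝ) - f = 2 ^ i * c := by exact_mod_cast hc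
  rw [← ex_int c]
  congr 1
  field_simp
  linarith

lemma mod_two_pow_succ_eq (z i : ℕ) :
    z % 2 ^ (i + 1) = z % 2 ^ i + 2 ^ i * (z.testBit i).toNat := by
  rw [Nat.mod_pow_succ, Nat.testBit_eq_decide_div_mod_eq]
  rcases Nat.mod_two_eq_zero_or_one (z / 2 ^ i) with h | h <;> simp [h]

/-- With equal lower bits and different bits `i`, the difference `z - f` is an odd multiple of `2 ^
i`, so the total phase is a half-integer. -/
lemma ex_quotient_of_testBit_ne {f z i : ℕ} (h : f % 2 ^ i = z % 2 ^ i)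
    (hb : f.testBit i ≠ z.testBit i) :
    ex (-(f : ℝ) / 2 ^ (i + 1)) * ex ((z : ℝ) / 2 ^ (i + 1)) = -1 := by
  rw [← ex_add]
  have hf := Nat.div_add_mod f (2 ^ (i + 1))
  have hz := Nat.div_add_mod z (2 ^ (i + 1))
  rw [mod_two_pow_succ_eq] at hf hz
  rw [h] at hf
  generalize f / 2 ^ (i + 1) = u at hf
  generalize z / 2 ^ (i + 1) = w at hz
  generalize z % 2 ^ i = c at hf hz
  have key : ∀ m : ℤ, ex (m + 1 / 2) = -1 := fun m => by rw [ex_add, ex_int, ex_half, one_mul]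
  have h2 : (2 : ℝ) ^ i ≠ 0 := by positivity
  have hf' := congrArg (Nat.cast : ℕ → ℝ) hf
  have hz' := congrArg (Nat.cast : ℕ → ℝ) hz
  cases hfb : f.testBit i <;> cases hzb : z.testBit i
  · exact absurd (hfb.trans hzb.symm) hb
  · rw [← key ((w : ℤ) - u)]
    congr 1
    rw [hfb] at hf'; rw [hzb] at hz'
    push_cast [Bool.toNat_false, Bool.toNat_true] at hf' hz' ⊢
    rw [← hf', ← hz', pow_succ]
    field_simp
    ring
  -- Here the exponent is `w - u - 1/2`, rewritten as an integer plus `1/2`.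
  · rw [← key ((w : ℤ) - u - 1)]
    congr 1
    rw [hfb] at hf'; rw [hzb] at hz'
    push_cast [Bool.toNat_false, Bool.toNat_true] at hf' hz' ⊢
    rw [← hf', ← hz', pow_succ]
    field_simp
    ring
  · exact absurd (hfb.trans hzb.symm) hb

/-- The paths `p` (to the isolated leaf) and `v` are followed through one coordinate. As long as
they coincide every factor is `1`; once they separate the response is `0` for good. The congruence
`h` records that all bits read so far agree, and `rf`, `rz` are the bits of the later coordinates.
-/
lemma response_filterPreProcess (f z m i : ℕ) (t : SplitTree) (p v rf rz : Path)
    (hp : IsLeaf t p) (hv : IsLeaf t v) (hpf : p <+: bitsFrom f i m ++ rf)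
    (hvz : v <+: bitsFrom z i m ++ rz) (h : f % 2 ^ i = z % 2 ^ i) :
    let r := (filterPreProcess f m (i + 1) t p).val
    (∃ v', IsLeaf r.2.1 v' ∧ v' <+: rz ∧ (v = p ↔ v' = r.2.2) ∧ response z (i + 1) r.1 = 1) ∨
      (v ≠ p ∧ response z (i + 1) r.1 = 0) := by
  induction m generalizing i t p v with
  | zero =>
    left
    exact ⟨v, hv, by simpa using hvz, Iff.rfl, rfl⟩
  | succ m ih =>
    rw [bitsFrom_succ, List.cons_append] at hpf hvz
    rcases t with _ | ⟨b, t⟩ | ⟨r, l⟩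
    · have hp' : p = [] := hp
      have hv' : v = [] := hv
      subst hp' hv'
      rw [filterPreProcess_leaf]
      left
      have hr := filterPreProcess_leaf_rest f m (i + 1 + 1) .leaf [] rfl
      -- Once the leaf is reached all remaining entries are `0`, which stands for an absent factor.
      have hz : ∀ m j, response z j (filterPreProcess f m j .leaf []).val.1 = 1 := by
        intro m
        induction m with
        | zero => intro j; rfl
        | succ m ih => intro j; rw [filterPreProcess_leaf]; simp [response, ih]
      refine ⟨[], ?_, List.nil_prefix, ?_, ?_⟩
      · have := hr.1
        rw [hr.2.1] at this
        simpa using this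
      · simpa using hr.2.1
      · simp only [response, if_true, one_mul, hz]
    · rcases p with _ | ⟨c, p⟩
      · exact absurd hp (by simp [IsLeaf])
      rcases v with _ | ⟨e, v⟩
      · exact absurd hv (by simp [IsLeaf])
      rw [List.cons_prefix_cons] at hpf hvz
      -- A node with one child gives no factor, but both paths use its only edge, so the bits agree
      -- and the congruence extends to the next level.
      have hbit : f.testBit i = z.testBit i := by rw [← hpf.1, ← hvz.1, hp.1, hv.1]
      have hmod : f % 2 ^ (i + 1) = z % 2 ^ (i + 1) := by
        rw [mod_two_pow_succ_eq, mod_two_pow_succ_eq, h, hbit]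
      have hec : e = c := by rw [hp.1, hv.1]
      have := ih (i + 1) t p v hp.2 hv.2 hpf.2 hvz.2 hmod
      rw [filterPreProcess_one]
      simpa [response, hec] using this
    · rcases p with _ | ⟨c, p⟩
      · exact absurd hp (by simp [IsLeaf])
      rcases v with _ | ⟨e, v⟩
      · exact absurd hv (by simp [IsLeaf])
      rw [List.cons_prefix_cons] at hpf hvz
      rw [isLeaf_two_cons] at hp hv
      rw [filterPreProcess_two]
      by_cases hec : e = c
      · subst hec
        have hbit : f.testBit i = z.testBit i := by rw [← hpf.1, ← hvz.1]
        have hmod : f % 2 ^ (i + 1) = z % 2 ^ (i + 1) := by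
          rw [mod_two_pow_succ_eq, mod_two_pow_succ_eq, h, hbit]
        have := ih (i + 1) _ p v hp hv hpf.2 hvz.2 hmod
        simpa [response, ex_ne_zero, ex_quotient_of_mod_eq hmod] using this
      · right
        have hbit : f.testBit i ≠ z.testBit i := by
          rw [← hpf.1, ← hvz.1]; exact Ne.symm hec
        simp [response, ex_ne_zero, ex_quotient_of_testBit_ne h hbit, hec]

lemma filterPreProcessAll_cons {a d : ℕ} (f : Idx a d) (q : Fin d) (qs : List (Fin d))
    (t : SplitTree) (p : Path) :
    let r := (filterPreProcess (f q).val a 1 t p).val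
    (filterPreProcessAll f (q :: qs) t p).val
      = (q, r.1) :: (filterPreProcessAll f qs r.2.1 r.2.2).val := rfl

lemma filterPreProcessAll_props {a d : ℕ} (f : Idx a d) (qs : List (Fin d)) (t : SplitTree)
    (p : Path) (hp : IsLeaf t p) :
    let gs := (filterPreProcessAll f qs t p).val
    gs.map Prod.fst = qs ∧ (∀ r ∈ gs, r.2.length = a) ∧ totalNonzeros gs ≤ weight t p := by
  induction qs generalizing t p with
  | nil => simp [filterPreProcessAll, totalNonzeros]
  | cons q qs ih =>
    have hr := filterPreProcess_leaf_rest (f q).val a 1 t p hp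
    have ih' := ih _ _ hr.1
    rw [filterPreProcessAll_cons]
    refine ⟨by simp [ih'.1], ?_, ?_⟩
    · intro r hr'
      rcases List.mem_cons.mp hr' with rfl | hr'
      · exact hr.2.2.1
      · exact ih'.2.1 r hr'
    · have h1 := hr.2.2.2
      have h2 := ih'.2.2
      simp only [totalNonzeros, List.map_cons, List.sum_cons] at h2 ⊢
      omega

lemma filterPreProcessAll_cost {a d : ℕ} (f : Idx a d) (qs : List (Fin d)) (t : SplitTree)
    (p : Path) : (filterPreProcessAll f qs t p).samples = 0 ∧
      (filterPreProcessAll f qs t p).steps ≤ qs.length * (8 * a + 4) + 1 := by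
  induction qs generalizing t p with
  | nil => simp [filterPreProcessAll]
  | cons q qs ih =>
    have h1 := filterPreProcess_cost (f q).val a 1 t p
    have h2 := ih (filterPreProcess (f q).val a 1 t p).val.2.1
      (filterPreProcess (f q).val a 1 t p).val.2.2
    have e1 : (filterPreProcessAll f (q :: qs) t p).samples
        = (filterPreProcess (f q).val a 1 t p).samples +
          ((filterPreProcessAll f qs (filterPreProcess (f q).val a 1 t p).val.2.1
            (filterPreProcess (f q).val a 1 t p).val.2.2).samples + 0) := rfl
    have e2 : (filterPreProcessAll f (q :: qs) t p).steps
        = (filterPreProcess (f q).val a 1 t p).steps +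
          ((filterPreProcessAll f qs (filterPreProcess (f q).val a 1 t p).val.2.1
            (filterPreProcess (f q).val a 1 t p).val.2.2).steps + 3) := rfl
    rw [e1, e2, List.length_cons, add_mul]
    omega

/-- Different leaves separate in some coordinate, and the zero factor found there kills the product.
-/
lemma totalResponse_filterPreProcessAll {a d : ℕ} (f ξ : Idx a d) (qs : List (Fin d))
    (t : SplitTree) (p v : Path) (hp : IsLeaf t p) (hv : IsLeaf t v) (hpf : p <+: bitsOf f qs)
    (hvξ : v <+: bitsOf ξ qs) :
    totalResponse ξ (filterPreProcessAll f qs t p).val = if v = p then 1 else 0 := by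
  induction qs generalizing t p v with
  | nil =>
    have h1 : p = [] := by simpa [bitsOf] using hpf
    have h2 : v = [] := by simpa [bitsOf] using hvξ
    simp [filterPreProcessAll, totalResponse, h1, h2]
  | cons q qs ih =>
    have hf : bitsOf f (q :: qs) = bitsFrom (f q).val 0 a ++ bitsOf f qs := rfl
    have hξ : bitsOf ξ (q :: qs) = bitsFrom (ξ q).val 0 a ++ bitsOf ξ qs := rfl
    rw [hf] at hpf
    rw [hξ] at hvξ
    have hr := filterPreProcess_leaf_rest (f q).val a 1 t p hp
    have hrest : (filterPreProcess (f q).val a 1 t p).val.2.2 <+: bitsOf f qs := by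
      rw [hr.2.1]
      have := hpf.drop a
      rwa [List.drop_left' (by simp [bitsFrom])] at this
    have hcons : ∀ (g : List ℂ) gs, totalResponse ξ ((q, g) :: gs)
        = response (ξ q).val 1 g * totalResponse ξ gs := fun g gs => by simp [totalResponse]
    rw [filterPreProcessAll_cons, hcons]
    -- Each coordinate starts at bit `0`, where the required congruence is modulo `1` and hence
    -- void.
    rcases response_filterPreProcess (f q).val (ξ q).val a 0 t p v _ _ hp hv hpf hvξ
      (by simp [Nat.mod_one]) with ⟨v', h1, h2, h3, h4⟩ | ⟨h1, h2⟩
    · rw [zero_add] at h1 h3 h4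
      rw [h4, one_mul, ih _ _ v' hr.1 h1 hrest h2]
      simp only [h3]
    · rw [zero_add] at h2
      rw [h2, zero_mul, if_neg h1]

/-- The filter for the leaf `v` of `T` is `1` on the frequency cone of `v` and `0` on the frequency
cones of the other leaves. -/
lemma isolation {a d : ℕ} (ξ : Idx a d) (T : SplitTree) (p v : Path) (hp : IsLeaf T p)
    (hv : IsLeaf T v) (hpl : p.length ≤ d * a) (hvξ : v <+: bits ξ) :
    totalResponse ξ (filterPreProcessAll (label a d p) (List.finRange d) T p).val
      = if v = p then 1 else 0 :=
  totalResponse_filterPreProcessAll _ _ _ _ _ _ hp hv (prefix_bits_label p hpl) hvξ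

/-! ## Filtered samples of the residual signal -/

/-- Convolution in time is multiplication in frequency; Fourier inversion is applied to each sample
`x (t - p)`. -/
lemma filteredSample_val {a d : ℕ} (x : Idx a d → ℂ) (t : Idx a d) (G : List (Idx a d × ℂ)) :
    ((2 ^ a) ^ d : ℂ) * (filteredSample x t G).val
      = ∑ ξ, dft x ξ * (transform G ξ * chr ξ t) := by
  induction G with
  | nil => simp [filteredSample, transform]
  | cons r G ih =>
    obtain ⟨p, c⟩ := r
    simp only [filteredSample, Run.val_bind, val_query, val_charge, mul_add, ih]
    have h := fourier_inversion x (t - p)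
    rw [mul_left_comm, ← h, Finset.mul_sum, ← Finset.sum_add_distrib]
    refine Finset.sum_congr rfl fun ξ _ => ?_
    simp only [transform, List.map_cons, List.sum_cons, sub_eq_add_neg, chr_add]
    ring

lemma filteredSample_samples {a d : ℕ} (x : Idx a d → ℂ) (t : Idx a d) (G : List (Idx a d × ℂ)) :
    (filteredSample x t G).samples = G.length := by
  induction G with
  | nil => simp [filteredSample]
  | cons r G ih => simp [filteredSample, ih]

lemma filteredSample_steps {a d : ℕ} (x : Idx a d → ℂ) (t : Idx a d) (G : List (Idx a d × ℂ)) :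
    (filteredSample x t G).steps = 5 * G.length + 1 := by
  induction G with
  | nil => simp [filteredSample]
  | cons r G ih => simp [filteredSample, ih]; ring

lemma spectrum_cons {a d : ℕ} (e : Entry a d) (chi : List (Entry a d)) (ξ : Idx a d) :
    spectrum (e :: chi) ξ = (if e.freq = ξ then e.coef else 0) + spectrum chi ξ := by
  simp [spectrum]

lemma sum_spectrum_mul {a d : ℕ} (chi : List (Entry a d)) (F : Idx a d → ℂ) :
    ∑ ξ, spectrum chi ξ * F ξ = (chi.map fun e => e.coef * F e.freq).sum := by
  induction chi with
  | nil => simp [spectrum]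
  | cons e chi ih => simp [spectrum_cons, add_mul, Finset.sum_add_distrib, ih]

lemma filteredSpectrum_val {a d : ℕ} (gs : List (Fin d × List ℂ)) (chi : List (Entry a d)) :
    (filteredSpectrum gs chi).val = ∑ ξ, spectrum chi ξ * totalResponse ξ gs := by
  rw [sum_spectrum_mul]
  induction chi with
  | nil => simp [filteredSpectrum]
  | cons e chi ih => simp [filteredSpectrum, ih, filterFrequencyAll_val]

lemma filteredSpectrum_samples {a d : ℕ} (gs : List (Fin d × List ℂ)) (chi : List (Entry a d)) :
    (filteredSpectrum gs chi).samples = 0 := by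
  induction chi with
  | nil => simp [filteredSpectrum]
  | cons e chi ih => simp [filteredSpectrum, ih, filterFrequencyAll_samples]

lemma filteredSpectrum_steps {a d : ℕ} (gs : List (Fin d × List ℂ)) (chi : List (Entry a d))
    (hlen : ∀ p ∈ gs, p.2.length = a) :
    (filteredSpectrum gs chi).steps ≤ chi.length * (gs.length * (11 * a + 5) + 5) + 1 := by
  induction chi with
  | nil => simp [filteredSpectrum]
  | cons e chi ih =>
    have := filterFrequencyAll_steps e.freq gs hlen
    simp only [filteredSpectrum, Run.steps_bind, steps_charge, List.length_cons,
      add_mul chi.length 1]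
    omega

lemma addRow_val {α : Type} (w : ℂ) (f h : α → ℂ) (l : List α) :
    (addRow w (l.map f) (l.map h)).val = l.map fun t => w * f t + h t := by
  induction l with
  | nil => simp [addRow]
  | cons t l ih => simp [addRow, ih]

lemma addRow_cost (w : ℂ) (l l' : List ℂ) :
    (addRow w l l').samples = 0 ∧ (addRow w l l').steps ≤ 5 * l.length + 1 := by
  induction l generalizing l' with
  | nil => simp [addRow]
  | cons z l ih =>
    rcases l' with _ | ⟨h, l'⟩
    · simp [addRow]
    · have := ih l'
      simp [addRow]; omega

lemma zeroRow_val {a d : ℕ} (Δs : List (Idx a d)) : (zeroRow Δs).val = Δs.map fun _ => 0 := by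
  induction Δs with
  | nil => simp [zeroRow]
  | cons t l ih => simp only [zeroRow, Run.val_bind, val_charge, ih, List.map_cons]

lemma zeroRow_cost {a d : ℕ} (Δs : List (Idx a d)) :
    (zeroRow Δs).samples = 0 ∧ (zeroRow Δs).steps = 2 * Δs.length + 1 := by
  induction Δs with
  | nil => simp [zeroRow]
  | cons t l ih => simp [zeroRow, ih]; ring

lemma phaseRow_val {a d : ℕ} (ξ : Idx a d) (Δs : List (Idx a d)) :
    (phaseRow ξ Δs).val = Δs.map (chr ξ) := by
  induction Δs with
  | nil => simp [phaseRow]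
  | cons t l ih => simp [phaseRow, ih, ex_dot]

lemma phaseRow_cost {a d : ℕ} (ξ : Idx a d) (Δs : List (Idx a d)) :
    (phaseRow ξ Δs).samples = 0 ∧ (phaseRow ξ Δs).steps = Δs.length * (2 * d + 4) + 1 := by
  induction Δs with
  | nil => simp [phaseRow]
  | cons t l ih => simp [phaseRow, ih]; ring

/-- The tables of all entries are correct. -/
def RowsCorrect {a d : ℕ} (Δs : List (Idx a d)) (chi : List (Entry a d)) : Prop :=
  ∀ e ∈ chi, e.row = Δs.map (chr e.freq)

lemma spectrumAtSamples_val {a d : ℕ} (gs : List (Fin d × List ℂ)) (Δs : List (Idx a d))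
    (chi : List (Entry a d)) (hrow : RowsCorrect Δs chi) :
    (spectrumAtSamples gs Δs chi).val
      = Δs.map fun t => ∑ ξ, spectrum chi ξ * (totalResponse ξ gs * chr ξ t) := by
  simp only [sum_spectrum_mul]
  induction chi with
  | nil => simp [spectrumAtSamples, zeroRow_val]
  | cons e chi ih =>
    have ih' := ih fun e he => hrow e (List.mem_cons_of_mem _ he)
    simp only [spectrumAtSamples, Run.val_bind, val_charge, ih', filterFrequencyAll_val,
      hrow e List.mem_cons_self, addRow_val, List.map_cons, List.sum_cons, mul_assoc]

lemma spectrumAtSamples_samples {a d : ℕ} (gs : List (Fin d × List ℂ)) (Δs : List (Idx a d))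
    (chi : List (Entry a d)) : (spectrumAtSamples gs Δs chi).samples = 0 := by
  induction chi with
  | nil => simp [spectrumAtSamples, zeroRow_cost]
  | cons e chi ih =>
    simp [spectrumAtSamples, ih, filterFrequencyAll_samples, (addRow_cost _ _ _).1]

lemma spectrumAtSamples_steps {a d : ℕ} (gs : List (Fin d × List ℂ)) (Δs : List (Idx a d))
    (chi : List (Entry a d)) (hlen : ∀ p ∈ gs, p.2.length = a) (hrow : RowsCorrect Δs chi) :
    (spectrumAtSamples gs Δs chi).steps
      ≤ chi.length * (gs.length * (11 * a + 5) + 5 * Δs.length + 5) + (2 * Δs.length + 1) := by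
  induction chi with
  | nil => simp [spectrumAtSamples, zeroRow_cost]
  | cons e chi ih =>
    have ih' := ih fun e he => hrow e (List.mem_cons_of_mem _ he)
    have h1 := filterFrequencyAll_steps e.freq gs hlen
    have h2 := (addRow_cost (e.coef * (filterFrequencyAll e.freq gs).val) e.row
      (spectrumAtSamples gs Δs chi).val).2
    have h3 : e.row.length = Δs.length := by rw [hrow e List.mem_cons_self, List.length_map]
    simp only [spectrumAtSamples, Run.steps_bind, steps_charge, val_charge, List.length_cons,
      add_mul chi.length 1]
    omega

lemma energy_val {a d : ℕ} (x : Idx a d → ℂ) (G : List (Idx a d × ℂ)) (Δs : List (Idx a d))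
    (h : Idx a d → ℂ) :
    (energy x G Δs (Δs.map h)).val = (Δs.map fun t =>
      Complex.normSq ((filteredSample x t G).val - 1 / ((2 ^ a) ^ d : ℂ) * h t)).sum := by
  induction Δs with
  | nil => simp [energy]
  | cons t l ih => simp only [energy, List.map_cons, Run.val_bind, val_charge, ih, List.sum_cons]

lemma energy_cost {a d : ℕ} (x : Idx a d → ℂ) (G : List (Idx a d × ℂ)) (Δs : List (Idx a d))
    (hs : List ℂ) : (energy x G Δs hs).samples ≤ Δs.length * G.length ∧
      (energy x G Δs hs).steps ≤ Δs.length * (5 * G.length + 8) + 1 := by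
  induction Δs generalizing hs with
  | nil => simp [energy]
  | cons t l ih =>
    rcases hs with _ | ⟨h, hs⟩
    · simp [energy]
    · have := ih hs
      simp only [energy, Run.samples_bind, Run.steps_bind, filteredSample_samples,
        filteredSample_steps, samples_charge, steps_charge, List.length_cons, add_mul l.length 1]
      omega

/-! ### Correctness of the zero test -/

/-- No partial sum of the spectrum, over a nonempty set of frequencies, vanishes at one of the
points. -/
def Generic {a d : ℕ} (x : Idx a d → ℂ) (Δs : List (Idx a d)) : Prop :=
  ∀ S : Finset (Idx a d), S.Nonempty → (∀ ξ ∈ S, dft x ξ ≠ 0) →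
    ∀ t ∈ Δs, ∑ ξ ∈ S, dft x ξ * chr ξ t ≠ 0

/-- `R` is the set of the frequencies that have not been recovered yet; all other coefficients are
correct. -/
structure Recovered {a d : ℕ} (x : Idx a d → ℂ) (chi : List (Entry a d)) (R : Finset (Idx a d)) :
    Prop where
  ne_zero : ∀ ξ ∈ R, dft x ξ ≠ 0
  mem : ∀ ξ ∈ R, spectrum chi ξ = 0
  not_mem : ∀ ξ ∉ R, spectrum chi ξ = dft x ξ

lemma totalResponse_of_covered {a d : ℕ} (ξ : Idx a d) (T : SplitTree) (p : Path)
    (hp : IsLeaf T p) (hpl : p.length ≤ d * a) (hξ : ∃ v, IsLeaf T v ∧ v <+: bits ξ) :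
    totalResponse ξ (filterPreProcessAll (label a d p) (List.finRange d) T p).val
      = if p <+: bits ξ then 1 else 0 := by
  by_cases h : p <+: bits ξ
  · rw [isolation ξ T p p hp hp hpl h, if_pos rfl, if_pos h]
  · obtain ⟨v, hv, hvξ⟩ := hξ
    rw [isolation ξ T p v hp hv hpl hvξ, if_neg h, if_neg]
    rintro rfl
    exact h hvξ

/-- Outside `R` the residual vanishes, so the response of the filter there is irrelevant. On `R`
every frequency lies below some leaf, and isolation makes the response the indicator of the cone of
`p`. -/
lemma residual_sum {a d : ℕ} {x : Idx a d → ℂ} {chi : List (Entry a d)} {R : Finset (Idx a d)}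
    (hR : Recovered x chi R) (T : SplitTree) (p : Path) (hp : IsLeaf T p)
    (hpl : p.length ≤ d * a) (hcov : ∀ ξ ∈ R, ∃ v, IsLeaf T v ∧ v <+: bits ξ) (F : Idx a d → ℂ) :
    let gs := (filterPreProcessAll (label a d p) (List.finRange d) T p).val
    ∑ ξ, dft x ξ * (totalResponse ξ gs * F ξ) - ∑ ξ, spectrum chi ξ * (totalResponse ξ gs * F ξ)
      = ∑ ξ ∈ R with p <+: bits ξ, dft x ξ * F ξ := by
  intro gs
  rw [← Finset.sum_sub_distrib, Finset.sum_filter,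
    ← Finset.sum_subset (Finset.subset_univ R)]
  · refine Finset.sum_congr rfl fun ξ hξ => ?_
    rw [hR.mem ξ hξ, totalResponse_of_covered ξ T p hp hpl (hcov ξ hξ)]
    split_ifs <;> ring
  · intro ξ _ hξ
    rw [hR.not_mem ξ hξ, sub_self]

lemma transform_filter {a d : ℕ} (ξ f : Idx a d) (T : SplitTree) (p : Path) (hp : IsLeaf T p) :
    let gs := (filterPreProcessAll f (List.finRange d) T p).val
    transform (filterTimeAll (a := a) gs).val ξ = totalResponse ξ gs := by
  intro gs
  have h := filterPreProcessAll_props f (List.finRange d) T p hp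
  exact transform_filterTimeAll ξ gs (by rw [h.1]; exact List.nodup_finRange d) h.2.1

lemma length_filter_le {a d : ℕ} (f : Idx a d) (T : SplitTree) (p : Path) (hp : IsLeaf T p) :
    (filterTimeAll (a := a) (filterPreProcessAll f (List.finRange d) T p).val).val.length
      ≤ 2 ^ weight T p := by
  rw [length_filterTimeAll]
  exact Nat.pow_le_pow_right (by norm_num)
    (filterPreProcessAll_props f (List.finRange d) T p hp).2.2

lemma zeroTest_val {a d : ℕ} (x : Idx a d → ℂ) (chi : List (Entry a d)) (T : SplitTree)
    (v : Path) (Δs : List (Idx a d)) :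
    let gs := (filterPreProcessAll (label a d v) (List.finRange d) T v).val
    (zeroTest x chi T v Δs).val = true ↔
      1 / (Δs.length : ℝ) * (energy x (filterTimeAll gs).val Δs
        (spectrumAtSamples gs Δs chi).val).val ≠ 0 := by
  intro gs
  change (if 1 / (Δs.length : ℝ) * (energy x (filterTimeAll gs).val Δs
        (spectrumAtSamples gs Δs chi).val).val = 0 then (pure false : Run Bool)
        else pure true).val = true ↔ _
  split_ifs with h
  · exact ⟨fun h' => absurd h' (by simp), fun h' => absurd h h'⟩
  · exact ⟨fun _ => h, fun _ => rfl⟩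

/-- An empty cone gives zero energy without any genericity. For a nonempty cone genericity makes
every summand of the energy nonzero, so one sample point suffices. -/
lemma zeroTest_iff {a d : ℕ} {x : Idx a d → ℂ} {chi : List (Entry a d)} {R : Finset (Idx a d)}
    {Δs : List (Idx a d)} (hgen : Generic x Δs) (hΔ : Δs ≠ []) (hrow : RowsCorrect Δs chi)
    (hR : Recovered x chi R) (T : SplitTree) (p : Path) (hp : IsLeaf T p)
    (hpl : p.length ≤ d * a) (hcov : ∀ ξ ∈ R, ∃ v, IsLeaf T v ∧ v <+: bits ξ) :
    (zeroTest x chi T p Δs).val = true ↔ ∃ ξ ∈ R, p <+: bits ξ := by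
  refine (zeroTest_val x chi T p Δs).trans ?_
  rw [spectrumAtSamples_val _ _ _ hrow, energy_val]
  set gs := (filterPreProcessAll (label a d p) (List.finRange d) T p).val with hgs
  have hN := pow_card_ne_zero a d
  have hH : ∀ t, (filteredSample x t (filterTimeAll gs).val).val - 1 / ((2 ^ a) ^ d : ℂ) *
      ∑ ξ, spectrum chi ξ * (totalResponse ξ gs * chr ξ t)
      = 1 / ((2 ^ a) ^ d : ℂ) * ∑ ξ ∈ R with p <+: bits ξ, dft x ξ * chr ξ t := by
    intro t
    rw [← residual_sum hR T p hp hpl hcov fun ξ => chr ξ t, mul_sub]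
    congr 1
    have h := filteredSample_val x t (filterTimeAll gs).val
    simp only [hgs, transform_filter _ _ T p hp] at h
    rw [← h, one_div, inv_mul_cancel_left₀ hN]
  simp only [hH]
  have hlen : (1 / (Δs.length : ℝ)) ≠ 0 := by
    have := List.length_pos_iff.mpr hΔ
    positivity
  constructor
  · intro h
    by_contra hne
    push Not at hne
    apply h
    have : (R.filter fun ξ => p <+: bits ξ) = ∅ := by
      rw [Finset.filter_eq_empty_iff]; exact fun ξ hξ => hne ξ hξ
    simp [this]
  · rintro ⟨ξ, hξ, hpξ⟩ h0
    rcases mul_eq_zero.mp h0 with h | h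
    · exact hlen h
    -- A vanishing sum of nonnegative terms forces the term of this one point to vanish.
    obtain ⟨t, ht⟩ := List.exists_mem_of_ne_nil _ hΔ
    have hz := List.all_zero_of_le_zero_le_of_sum_eq_zero (by
      intro y hy
      obtain ⟨u, _, rfl⟩ := List.mem_map.mp hy
      exact Complex.normSq_nonneg _) h (List.mem_map.mpr ⟨t, ht, rfl⟩)
    rw [Complex.normSq_eq_zero] at hz
    rcases mul_eq_zero.mp hz with h | h
    · exact one_div_ne_zero hN h
    · refine hgen _ ⟨ξ, ?_⟩ ?_ t ht h
      · simp [hξ, hpξ]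
      · intro η hη
        exact hR.ne_zero η (Finset.mem_filter.mp hη).1

/-! ## Cost of the zero tests and estimates -/

/-- The bound `2 * k` allows for a tested child, whose weight exceeds that of its parent by one. The
assumption `d * a ≤ Δs.length` absorbs the cost of building and evaluating filters into `k *
Δs.length`. -/
lemma zeroTest_cost {a d k : ℕ} (ha : 1 ≤ a) (hd : 1 ≤ d) (x : Idx a d → ℂ)
    (chi : List (Entry a d)) (T : SplitTree) (p : Path) (Δs : List (Idx a d))
    (hrow : RowsCorrect Δs chi) (hp : IsLeaf T p) (hpl : p.length ≤ d * a)
    (hS : d * a ≤ Δs.length) (hk : chi.length ≤ k) (hk1 : 1 ≤ k) (hw : 2 ^ weight T p ≤ 2 * k) :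
    (zeroTest x chi T p Δs).samples ≤ 2 * (k * Δs.length) ∧
      (zeroTest x chi T p Δs).steps ≤ 120 * (k * Δs.length) := by
  set gs := (filterPreProcessAll (label a d p) (List.finRange d) T p).val with hgs
  have hprops := filterPreProcessAll_props (label a d p) (List.finRange d) T p hp
  have hlen : ∀ r ∈ gs, r.2.length = a := hprops.2.1
  have hgl : gs.length = d := by
    have := congrArg List.length hprops.1
    simpa using this
  have hsam : (zeroTest x chi T p Δs).samples = (readLabel p).samples +
      ((filterPreProcessAll (label a d p) (List.finRange d) T p).samples +
      ((filterTimeAll (a := a) gs).samples + ((spectrumAtSamples gs Δs chi).samples +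
      ((energy x (filterTimeAll gs).val Δs (spectrumAtSamples gs Δs chi).val).samples +
      (0 + (if 1 / (Δs.length : ℝ) * (energy x (filterTimeAll gs).val Δs
        (spectrumAtSamples gs Δs chi).val).val = 0 then (pure false : Run Bool)
        else pure true).samples))))) := rfl
  have hste : (zeroTest x chi T p Δs).steps = (readLabel p).steps +
      ((filterPreProcessAll (label a d p) (List.finRange d) T p).steps +
      ((filterTimeAll (a := a) gs).steps + ((spectrumAtSamples gs Δs chi).steps +
      ((energy x (filterTimeAll gs).val Δs (spectrumAtSamples gs Δs chi).val).steps +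
      ((Δs.length + 3) + (if 1 / (Δs.length : ℝ) * (energy x (filterTimeAll gs).val Δs
        (spectrumAtSamples gs Δs chi).val).val = 0 then (pure false : Run Bool)
        else pure true).steps))))) := rfl
  have hif1 : (if 1 / (Δs.length : ℝ) * (energy x (filterTimeAll gs).val Δs
        (spectrumAtSamples gs Δs chi).val).val = 0 then (pure false : Run Bool)
        else pure true).samples = 0 := by split_ifs <;> rfl
  have hif2 : (if 1 / (Δs.length : ℝ) * (energy x (filterTimeAll gs).val Δs
        (spectrumAtSamples gs Δs chi).val).val = 0 then (pure false : Run Bool)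
        else pure true).steps = 0 := by split_ifs <;> rfl
  have hen := energy_cost x (filterTimeAll gs).val Δs (spectrumAtSamples gs Δs chi).val
  have hG : (filterTimeAll (a := a) gs).val.length ≤ 2 * k :=
    (length_filter_le (label a d p) T p hp).trans hw
  have hW : 2 ^ totalNonzeros gs ≤ 2 * k := by rwa [length_filterTimeAll] at hG
  have h1 := filterPreProcessAll_cost (label a d p) (List.finRange d) T p
  have h2 := filterTimeAll_steps gs hlen
  have h3 := spectrumAtSamples_steps gs Δs chi hlen hrow
  rw [hif1, readLabel_samples, h1.1, filterTimeAll_samples, spectrumAtSamples_samples] at hsam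
  rw [hif2, readLabel_steps] at hste
  rw [hgl] at h2 h3
  rw [List.length_finRange] at h1
  generalize Δs.length = S at *
  have hda : d ≤ d * a := Nat.le_mul_of_pos_right _ ha
  have hL : 1 ≤ d * a := le_trans hd hda
  have hkS : S ≤ k * S := Nat.le_mul_of_pos_left _ hk1
  constructor
  · have : S * (filterTimeAll (a := a) gs).val.length ≤ S * (2 * k) := Nat.mul_le_mul_left _ hG
    have e : S * (2 * k) = 2 * (k * S) := by ring
    omega
  · have b1 : d * (8 * a + 4) ≤ 12 * S := by
      have : d * (8 * a + 4) = 8 * (d * a) + 4 * d := by ring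
      omega
    have b2 : d * ((11 * a + 12) * 2 ^ totalNonzeros gs) ≤ 46 * (k * S) := by
      calc d * ((11 * a + 12) * 2 ^ totalNonzeros gs)
          = (11 * (d * a) + 12 * d) * 2 ^ totalNonzeros gs := by ring
        _ ≤ (23 * S) * (2 * k) := Nat.mul_le_mul (by omega) hW
        _ = _ := by ring
    have b3 : chi.length * (d * (11 * a + 5) + 5 * S + 5) ≤ 26 * (k * S) := by
      calc chi.length * (d * (11 * a + 5) + 5 * S + 5) ≤ k * (26 * S) := by
            refine Nat.mul_le_mul hk ?_
            have : d * (11 * a + 5) = 11 * (d * a) + 5 * d := by ring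
            omega
        _ = _ := by ring
    have b4 : S * (5 * (filterTimeAll (a := a) gs).val.length + 8) ≤ 18 * (k * S) := by
      calc S * (5 * (filterTimeAll (a := a) gs).val.length + 8) ≤ S * (18 * k) :=
            Nat.mul_le_mul_left _ (by omega)
        _ = _ := by ring
    omega

lemma addCoef_spectrum {a d : ℕ} (Δs : List (Idx a d)) (f : Idx a d) (z : ℂ)
    (chi : List (Entry a d)) (ξ : Idx a d) :
    spectrum (addCoef Δs f z chi).val ξ = spectrum chi ξ + if f = ξ then z else 0 := by
  induction chi with
  | nil => simp [addCoef, spectrum]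
  | cons e es ih =>
    by_cases h : e.freq = f
    · simp only [addCoef, h, if_true, Run.val_bind, val_charge, spectrum_cons]
      split_ifs <;> ring
    · simp only [addCoef, h, if_false, Run.val_bind, val_charge, spectrum_cons, ih]
      ring

lemma addCoef_rows {a d : ℕ} (Δs : List (Idx a d)) (f : Idx a d) (z : ℂ)
    (chi : List (Entry a d)) (hrow : RowsCorrect Δs chi) :
    RowsCorrect Δs (addCoef Δs f z chi).val := by
  induction chi with
  | nil => simp [addCoef, RowsCorrect, phaseRow_val]
  | cons e es ih =>
    have ih' := ih fun e he => hrow e (List.mem_cons_of_mem _ he)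
    have he := hrow e List.mem_cons_self
    by_cases h : e.freq = f
    · simp only [addCoef, h, if_true, Run.val_bind, val_charge]
      intro e' he'
      rcases List.mem_cons.mp he' with rfl | he'
      · rw [h] at he; exact he
      · exact hrow e' (List.mem_cons_of_mem _ he')
    · simp only [addCoef, h, if_false, Run.val_bind, val_charge]
      intro e' he'
      rcases List.mem_cons.mp he' with rfl | he'
      · exact he
      · exact ih' e' he'

/-- The list grows by at most one entry, which balances the frequency leaving `R`. The term
`Δs.length * (2 * d + 4)` is the phase table of a new frequency. -/
lemma addCoef_cost {a d : ℕ} (Δs : List (Idx a d)) (f : Idx a d) (z : ℂ)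
    (chi : List (Entry a d)) :
    (addCoef Δs f z chi).val.length ≤ chi.length + 1 ∧ (addCoef Δs f z chi).samples = 0 ∧
      (addCoef Δs f z chi).steps ≤ 3 * chi.length + Δs.length * (2 * d + 4) + 6 := by
  induction chi with
  | nil => simp [addCoef, phaseRow_cost]
  | cons e es ih =>
    by_cases h : e.freq = f
    · simp [addCoef, h]
    · simp [addCoef, h]; omega

lemma estimateLeaf_val {a d : ℕ} {x : Idx a d → ℂ} {chi : List (Entry a d)}
    {R : Finset (Idx a d)} (Δs : List (Idx a d)) (hR : Recovered x chi R) (T : SplitTree)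
    (p : Path) (hp : IsLeaf T p) (hpl : p.length ≤ d * a)
    (hcov : ∀ ξ ∈ R, ∃ v, IsLeaf T v ∧ v <+: bits ξ) :
    (estimateLeaf x Δs T chi p).val = ((remove T p).val,
      (addCoef Δs (label a d p) (∑ ξ ∈ R with p <+: bits ξ, dft x ξ) chi).val) := by
  set gs := (filterPreProcessAll (label a d p) (List.finRange d) T p).val with hgs
  have h0 : (estimateLeaf x Δs T chi p).val = ((remove T p).val,
      (addCoef Δs (label a d p) (((2 ^ a) ^ d : ℂ) * (filteredSample x 0 (filterTimeAll gs).val).val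
        - (filteredSpectrum gs chi).val) chi).val) := rfl
  rw [h0, filteredSample_val, filteredSpectrum_val]
  have h := residual_sum hR T p hp hpl hcov fun ξ => chr ξ 0
  simp only [chr_zero, mul_one, hgs, transform_filter _ _ T p hp] at h ⊢
  rw [h]

/-- The cost of the phase table stays a separate summand: it may exceed `O(k * Δs.length)` by a
factor `d`, and is paid once per recovered frequency rather than once per iteration. -/
lemma estimateLeaf_cost {a d k : ℕ} (ha : 1 ≤ a) (hd : 1 ≤ d) (x : Idx a d → ℂ)
    (chi : List (Entry a d)) (T : SplitTree) (p : Path) (Δs : List (Idx a d))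
    (hp : IsLeaf T p) (hpl : p.length ≤ d * a)
    (hS : d * a ≤ Δs.length) (hk : chi.length ≤ k) (hk1 : 1 ≤ k) (hw : 2 ^ weight T p ≤ k) :
    (estimateLeaf x Δs T chi p).samples ≤ k * Δs.length ∧
      (estimateLeaf x Δs T chi p).steps
        ≤ 120 * (k * Δs.length) + Δs.length * (2 * d + 4) := by
  set gs := (filterPreProcessAll (label a d p) (List.finRange d) T p).val with hgs
  have hprops := filterPreProcessAll_props (label a d p) (List.finRange d) T p hp
  have hlen : ∀ r ∈ gs, r.2.length = a := hprops.2.1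
  have hgl : gs.length = d := by
    have := congrArg List.length hprops.1
    simpa using this
  obtain ⟨z, hsam, hste⟩ : ∃ z,
      (estimateLeaf x Δs T chi p).samples = (readLabel p).samples +
      ((filterPreProcessAll (label a d p) (List.finRange d) T p).samples +
      ((filterTimeAll (a := a) gs).samples + ((filteredSpectrum gs chi).samples +
      ((filteredSample x 0 (filterTimeAll gs).val).samples + (0 +
      ((addCoef Δs (label a d p) z chi).samples + ((remove T p).samples + 0))))))) ∧
      (estimateLeaf x Δs T chi p).steps = (readLabel p).steps +
      ((filterPreProcessAll (label a d p) (List.finRange d) T p).steps +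
      ((filterTimeAll (a := a) gs).steps + ((filteredSpectrum gs chi).steps +
      ((filteredSample x 0 (filterTimeAll gs).val).steps + (3 +
      ((addCoef Δs (label a d p) z chi).steps + ((remove T p).steps + 0))))))) :=
    ⟨_, rfl, rfl⟩
  have hG : (filterTimeAll (a := a) gs).val.length ≤ k :=
    (length_filter_le (label a d p) T p hp).trans hw
  have hW : 2 ^ totalNonzeros gs ≤ k := by rwa [length_filterTimeAll] at hG
  have h1 := filterPreProcessAll_cost (label a d p) (List.finRange d) T p
  have h2 := filterTimeAll_steps gs hlen
  have h3 := filteredSpectrum_steps gs chi hlen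
  have h4 := addCoef_cost Δs (label a d p) z chi
  have h5 := remove_cost T p
  rw [readLabel_samples, h1.1, filterTimeAll_samples, filteredSpectrum_samples, h4.2.1, h5.1,
    filteredSample_samples] at hsam
  rw [readLabel_steps, filteredSample_steps] at hste
  rw [hgl] at h2 h3
  rw [List.length_finRange] at h1
  generalize Δs.length = S at *
  have hda : d ≤ d * a := Nat.le_mul_of_pos_right _ ha
  have hL : 1 ≤ d * a := le_trans hd hda
  have hkS : S ≤ k * S := Nat.le_mul_of_pos_left _ hk1
  have hkS' : k ≤ k * S := Nat.le_mul_of_pos_right _ (by omega)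
  constructor
  · omega
  · have b1 : d * (8 * a + 4) ≤ 12 * S := by
      have : d * (8 * a + 4) = 8 * (d * a) + 4 * d := by ring
      omega
    have b2 : d * ((11 * a + 12) * 2 ^ totalNonzeros gs) ≤ 23 * (k * S) := by
      calc d * ((11 * a + 12) * 2 ^ totalNonzeros gs)
          = (11 * (d * a) + 12 * d) * 2 ^ totalNonzeros gs := by ring
        _ ≤ (23 * S) * k := Nat.mul_le_mul (by omega) hW
        _ = _ := by ring
    have b3 : chi.length * (d * (11 * a + 5) + 5) ≤ 21 * (k * S) := by
      calc chi.length * (d * (11 * a + 5) + 5) ≤ k * (21 * S) := by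
            refine Nat.mul_le_mul hk ?_
            have : d * (11 * a + 5) = 11 * (d * a) + 5 * d := by ring
            omega
        _ = _ := by ring
    omega

/-! ## The main loop -/

/-- Leaves are prefix-free, so the cones of distinct leaves are disjoint. -/
lemma isLeaf_prefix_unique (T : SplitTree) (p q w : Path) (hp : IsLeaf T p) (hq : IsLeaf T q)
    (hpw : p <+: w) (hqw : q <+: w) : p = q := by
  induction T generalizing p q w with
  | leaf => exact Eq.trans hp (Eq.symm hq)
  | one b t ih =>
    rcases p with _ | ⟨c, p⟩
    · exact absurd hp (by simp [IsLeaf])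
    rcases q with _ | ⟨e, q⟩
    · exact absurd hq (by simp [IsLeaf])
    rcases w with _ | ⟨g, w⟩
    · simp at hpw
    rw [List.cons_prefix_cons] at hpw hqw
    rw [ih p q w hp.2 hq.2 hpw.2 hqw.2, hpw.1, hqw.1]
  | two r l ihr ihl =>
    rcases p with _ | ⟨c, p⟩
    · exact absurd hp (by simp [IsLeaf])
    rcases q with _ | ⟨e, q⟩
    · exact absurd hq (by simp [IsLeaf])
    rcases w with _ | ⟨g, w⟩
    · simp at hpw
    rw [List.cons_prefix_cons] at hpw hqw
    obtain ⟨rfl, hpw⟩ := hpw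
    obtain ⟨rfl, hqw⟩ := hqw
    cases e
    · rw [ihr p q w hp hq hpw hqw]
    · rw [ihl p q w hp hq hpw hqw]

/-- The node at depth `dep ξ` on the path to the frequency `ξ`. -/
def node {a d : ℕ} (dep : Idx a d → ℕ) (ξ : Idx a d) : Path := (bits ξ).take (dep ξ)

/-- The invariant of the main loop: the frequencies `R` remain to be recovered, and the leaves of
the tree are the ancestors at depth `dep ξ` of the `ξ ∈ R`. -/
structure LoopInv {a d : ℕ} (x : Idx a d → ℂ) (Δs : List (Idx a d)) (k : ℕ)
    (T : Option SplitTree) (chi : List (Entry a d)) (R : Finset (Idx a d)) (dep : Idx a d → ℕ) :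
    Prop where
  recovered : Recovered x chi R
  rows : RowsCorrect Δs chi
  card : chi.length + R.card ≤ k
  depth_le : ∀ ξ ∈ R, dep ξ ≤ d * a
  covered : ∀ ξ ∈ R, IsLeafOpt T (node dep ξ)
  inhabited : ∀ p, IsLeafOpt T p → ∃ ξ ∈ R, p = node dep ξ

/-- The number of iterations that remain is at most this number. -/
def potential {a d : ℕ} (R : Finset (Idx a d)) (dep : Idx a d → ℕ) : ℕ :=
  ∑ ξ ∈ R, (d * a + 1 - dep ξ)

lemma isLeafOpt_some (T : SplitTree) (p : Path) : IsLeafOpt (some T) p ↔ IsLeaf T p := by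
  simp [IsLeafOpt]

lemma node_prefix {a d : ℕ} (dep : Idx a d → ℕ) (ξ : Idx a d) : node dep ξ <+: bits ξ :=
  List.take_prefix _ _

lemma length_node {a d : ℕ} {dep : Idx a d → ℕ} {ξ : Idx a d} (h : dep ξ ≤ d * a) :
    (node dep ξ).length = dep ξ := by
  simp [node, h]

/-- At full depth the cone of `v` is a single frequency. It belongs to `R`, because the invariant
puts an unrecovered frequency below every leaf, so the filtered residual is exactly its coefficient.
-/
lemma estimateLeaf_inv {a d k : ℕ} {x : Idx a d → ℂ} {Δs : List (Idx a d)} {T : SplitTree}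
    {chi : List (Entry a d)} {R : Finset (Idx a d)} {dep : Idx a d → ℕ}
    (h : LoopInv x Δs k (some T) chi R dep) (v : Path) (hv : IsLeaf T v)
    (hvl : v.length = d * a) :
    label a d v ∈ R ∧ dep (label a d v) = d * a ∧
    LoopInv x Δs k (estimateLeaf x Δs T chi v).val.1 (estimateLeaf x Δs T chi v).val.2
      (R.erase (label a d v)) dep := by
  have hcov : ∀ ξ ∈ R, ∃ v, IsLeaf T v ∧ v <+: bits ξ := fun ξ hξ =>
    ⟨node dep ξ, (isLeafOpt_some _ _).mp (h.covered ξ hξ), node_prefix _ _⟩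
  have hbits := bits_label (a := a) (d := d) v hvl
  have huniq : ∀ ξ : Idx a d, v <+: bits ξ → ξ = label a d v := fun ξ hξ =>
    bits_injective (by rw [hbits]; exact (hξ.eq_of_length (by simp [hvl])).symm)
  obtain ⟨ξ₀, hξ₀, hv₀⟩ := h.inhabited v ((isLeafOpt_some _ _).mpr hv)
  have he : ξ₀ = label a d v := huniq ξ₀ (hv₀ ▸ node_prefix _ _)
  have hdep : dep ξ₀ = d * a := by
    rw [← length_node (h.depth_le ξ₀ hξ₀), ← hv₀, hvl]
  rw [he] at hξ₀ hdep hv₀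
  rw [estimateLeaf_val Δs h.recovered T v hv hvl.le hcov]
  have hsum : ∑ ξ ∈ R with v <+: bits ξ, dft x ξ = dft x (label a d v) := by
    have : (R.filter fun ξ => v <+: bits ξ) = {label a d v} := by
      ext ξ
      simp only [Finset.mem_filter, Finset.mem_singleton]
      refine ⟨fun hξ => huniq ξ hξ.2, ?_⟩
      rintro rfl
      exact ⟨hξ₀, by rw [hbits]⟩
    rw [this, Finset.sum_singleton]
  rw [hsum]
  refine ⟨hξ₀, hdep, ⟨?_, ?_, ?_⟩, addCoef_rows _ _ _ _ h.rows, ?_, ?_, ?_, ?_⟩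
  · exact fun ξ hξ => h.recovered.ne_zero ξ (Finset.mem_of_mem_erase hξ)
  · intro ξ hξ
    rw [addCoef_spectrum, h.recovered.mem ξ (Finset.mem_of_mem_erase hξ),
      if_neg (Finset.ne_of_mem_erase hξ).symm, add_zero]
  · intro ξ hξ
    rw [addCoef_spectrum]
    by_cases hl : label a d v = ξ
    · rw [if_pos hl, ← hl, h.recovered.mem _ hξ₀, zero_add]
    · rw [if_neg hl, add_zero]
      exact h.recovered.not_mem ξ fun hR => hξ (Finset.mem_erase.mpr ⟨Ne.symm hl, hR⟩)
  · have h1 := (addCoef_cost Δs (label a d v) (dft x (label a d v)) chi).1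
    have h2 := Finset.card_erase_add_one hξ₀
    have h3 := h.card
    dsimp only
    omega
  · exact fun ξ hξ => h.depth_le ξ (Finset.mem_of_mem_erase hξ)
  · intro ξ hξ
    rw [isLeaf_remove T v hv]
    have hR := Finset.mem_of_mem_erase hξ
    refine ⟨(isLeafOpt_some _ _).mp (h.covered ξ hR), fun hn => ?_⟩
    exact Finset.ne_of_mem_erase hξ (huniq ξ (hn ▸ node_prefix _ _))
  · intro p hp
    rw [isLeaf_remove T v hv] at hp
    obtain ⟨ξ, hξ, rfl⟩ := h.inhabited p ((isLeafOpt_some _ _).mpr hp.1)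
    refine ⟨ξ, Finset.mem_erase.mpr ⟨?_, hξ⟩, rfl⟩
    rintro rfl
    exact hp.2 hv₀.symm

/-- The last step of the exploration of the children of `v`, given the outcomes of the tests of the
right and of the left child. -/
def addChildren (T : SplitTree) (v : Path) : Bool → Bool → Run SplitTree
  | true, true => graft (.two .leaf .leaf) T v
  | true, false => graft (.one false .leaf) T v
  | false, true => graft (.one true .leaf) T v
  | false, false => charge 1 T

lemma expandLeaf_run {a d : ℕ} (x : Idx a d → ℂ) (Δs : List (Idx a d)) (T : SplitTree)
    (chi : List (Entry a d)) (v : Path) :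
    let test := fun b => zeroTest x chi (graft (.two .leaf .leaf) T v).val (v ++ [b]) Δs
    let g := addChildren T v (test false).val (test true).val
    (expandLeaf x Δs T chi v).val = (some g.val, chi) ∧
    (expandLeaf x Δs T chi v).samples = (graft (.two .leaf .leaf) T v).samples +
      ((test false).samples + ((test true).samples + g.samples)) ∧
    (expandLeaf x Δs T chi v).steps = (graft (.two .leaf .leaf) T v).steps +
      ((2 * v.length + 2) + ((test false).steps + ((test true).steps + (2 + g.steps)))) := by
  intro test g
  simp only [expandLeaf, Run.val_bind, Run.samples_bind, Run.steps_bind, samples_tick, steps_tick,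
    zero_add, g, test]
  generalize zeroTest x chi (graft (.two .leaf .leaf) T v).val (v ++ [false]) Δs = r
  generalize zeroTest x chi (graft (.two .leaf .leaf) T v).val (v ++ [true]) Δs = l
  obtain ⟨_ | _, _, _⟩ := r <;> obtain ⟨_ | _, _, _⟩ := l <;> exact ⟨rfl, rfl, rfl⟩

/-- The hypothesis `hex` excludes the outcome in which both tests fail; the tree would then be
unchanged and the loop would make no progress. -/
lemma expandLeaf_val {a d : ℕ} (x : Idx a d → ℂ) (Δs : List (Idx a d)) (T : SplitTree)
    (chi : List (Entry a d)) (v : Path) (test : Bool → Prop) (hv : IsLeaf T v)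
    (htest : ∀ b, (zeroTest x chi (graft (.two .leaf .leaf) T v).val (v ++ [b]) Δs).val = true ↔
      test b) (hex : ∃ b, test b) :
    (expandLeaf x Δs T chi v).val.2 = chi ∧ ∀ p, IsLeafOpt (expandLeaf x Δs T chi v).val.1 p ↔
      (IsLeaf T p ∧ p ≠ v) ∨ ∃ b, p = v ++ [b] ∧ test b := by
  have hrun := (expandLeaf_run x Δs T chi v).1
  dsimp only at hrun
  rw [hrun]
  refine ⟨rfl, fun p => ?_⟩
  have hf := htest false
  have ht := htest true
  have htwo : ∀ p', IsLeaf (.two .leaf .leaf) p' ↔ p' = [false] ∨ p' = [true] := by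
    rintro (_ | ⟨_ | _, p'⟩) <;> simp [IsLeaf]
  have hone : ∀ c p', IsLeaf (.one c .leaf) p' ↔ p' = [c] := by
    rintro c (_ | ⟨e, p'⟩) <;> simp [IsLeaf]
  rw [isLeafOpt_some]
  cases h1 : (zeroTest x chi (graft (.two .leaf .leaf) T v).val (v ++ [false]) Δs).val <;>
    cases h2 : (zeroTest x chi (graft (.two .leaf .leaf) T v).val (v ++ [true]) Δs).val <;>
    rw [h1] at hf <;> rw [h2] at ht <;> simp only [true_iff, Bool.false_eq_true, false_iff] at hf ht
  · obtain ⟨_ | _, hb⟩ := hex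
    · exact absurd hb hf
    · exact absurd hb ht
  · simp only [addChildren, isLeaf_graft _ _ _ hv, hone]
    simp [hf, ht]
  · simp only [addChildren, isLeaf_graft _ _ _ hv, hone]
    simp [hf, ht]
  · simp only [addChildren, isLeaf_graft _ _ _ hv, htwo]
    simp [hf, ht, and_or_left, exists_or]

/-- The tests take place in the tree with both children of `v`, whose leaves still cover `R`; hence
they are exact. A child is kept precisely when it has a frequency of `R` below it, so the invariant
persists with the frequencies below `v` one level deeper. -/
lemma expandLeaf_inv {a d k : ℕ} {x : Idx a d → ℂ} {Δs : List (Idx a d)} {T : SplitTree}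
    {chi : List (Entry a d)} {R : Finset (Idx a d)} {dep : Idx a d → ℕ}
    (hgen : Generic x Δs) (hΔ : Δs ≠ [])
    (h : LoopInv x Δs k (some T) chi R dep) (v : Path) (hv : IsLeaf T v)
    (hvl : v.length < d * a) :
    ∃ dep', potential R dep' < potential R dep ∧
      LoopInv x Δs k (expandLeaf x Δs T chi v).val.1 (expandLeaf x Δs T chi v).val.2 R dep' := by
  classical
  have hleaf : ∀ ξ ∈ R, IsLeaf T (node dep ξ) := fun ξ hξ =>
    (isLeafOpt_some _ _).mp (h.covered ξ hξ)
  have hext : ∀ ξ : Idx a d, v <+: bits ξ → ∃ b, v ++ [b] <+: bits ξ ∧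
      (bits ξ).take (v.length + 1) = v ++ [b] := by
    intro ξ hξ
    have hl : v.length < (bits ξ).length := by simpa using hvl
    refine ⟨(bits ξ)[v.length], ?_⟩
    have : (bits ξ).take (v.length + 1) = v ++ [(bits ξ)[v.length]] := by
      rw [List.take_succ_eq_append_getElem hl, ← List.prefix_iff_eq_take.mp hξ]
    exact ⟨this ▸ List.take_prefix _ _, this⟩
  have hnode : ∀ ξ ∈ R, ∀ b, v ++ [b] <+: bits ξ → node dep ξ = v := fun ξ hξ b hb =>
    isLeaf_prefix_unique T _ _ _ (hleaf ξ hξ) hv (node_prefix _ _)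
      ((List.prefix_append v [b]).trans hb)
  have hdepv : ∀ ξ ∈ R, node dep ξ = v → dep ξ = v.length := fun ξ hξ hn => by
    rw [← hn, length_node (h.depth_le ξ hξ)]
  have hvp : ∀ b, IsLeaf (graft (.two .leaf .leaf) T v).val (v ++ [b]) := by
    intro b
    rw [isLeaf_graft _ _ _ hv]
    exact Or.inr ⟨[b], rfl, by cases b <;> rfl⟩
  have hcov : ∀ ξ ∈ R, ∃ u, IsLeaf (graft (.two .leaf .leaf) T v).val u ∧ u <+: bits ξ := by
    intro ξ hξ
    by_cases hn : node dep ξ = v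
    · obtain ⟨b, hb, _⟩ := hext ξ (hn ▸ node_prefix _ _)
      exact ⟨_, hvp b, hb⟩
    · exact ⟨node dep ξ, (isLeaf_graft _ _ _ hv _).mpr (Or.inl ⟨hleaf ξ hξ, hn⟩), node_prefix _ _⟩
  obtain ⟨ξ₀, hξ₀, hv₀⟩ := h.inhabited v ((isLeafOpt_some _ _).mpr hv)
  obtain ⟨b₀, hb₀, _⟩ := hext ξ₀ (hv₀ ▸ node_prefix _ _)
  obtain ⟨hchi, hnew⟩ := expandLeaf_val x Δs T chi v (fun b => ∃ ξ ∈ R, v ++ [b] <+: bits ξ) hv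
    (fun b => zeroTest_iff hgen hΔ h.rows h.recovered _ _ (hvp b)
      (by simpa using hvl) hcov) ⟨b₀, ξ₀, hξ₀, hb₀⟩
  set dep' : Idx a d → ℕ := fun ξ => if node dep ξ = v then dep ξ + 1 else dep ξ with hdep'
  have hd1 : ∀ ξ, node dep ξ = v → dep' ξ = dep ξ + 1 := fun ξ hn => by simp [hdep', hn]
  have hd2 : ∀ ξ, node dep ξ ≠ v → dep' ξ = dep ξ := fun ξ hn => by simp [hdep', hn]
  have hn2 : ∀ ξ, node dep ξ ≠ v → node dep' ξ = node dep ξ := fun ξ hn => by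
    simp only [node, hd2 ξ hn]
  have hn1 : ∀ ξ ∈ R, ∀ b, v ++ [b] <+: bits ξ → node dep' ξ = v ++ [b] := fun ξ hξ b hb => by
    have hn := hnode ξ hξ b hb
    rw [node, hd1 ξ hn, hdepv ξ hξ hn]
    have := List.prefix_iff_eq_take.mp hb
    rw [List.length_append, List.length_singleton] at this
    exact this.symm
  refine ⟨dep', ?_, ?_⟩
  · refine Finset.sum_lt_sum (fun ξ _ => ?_) ⟨ξ₀, hξ₀, ?_⟩
    · by_cases hn : node dep ξ = v
      · rw [hd1 ξ hn]; omega
      · rw [hd2 ξ hn]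
    -- The truncated difference does drop, because `v` lies strictly above level `d * a`.
    · rw [hd1 ξ₀ hv₀.symm, hdepv ξ₀ hξ₀ hv₀.symm]; omega
  · rw [hchi]
    refine ⟨h.recovered, h.rows, h.card, ?_, ?_, ?_⟩
    · intro ξ hξ
      by_cases hn : node dep ξ = v
      · rw [hd1 ξ hn, hdepv ξ hξ hn]; omega
      · rw [hd2 ξ hn]; exact h.depth_le ξ hξ
    · intro ξ hξ
      rw [hnew]
      by_cases hn : node dep ξ = v
      · obtain ⟨b, hb, _⟩ := hext ξ (hn ▸ node_prefix _ _)
        exact Or.inr ⟨b, hn1 ξ hξ b hb, ξ, hξ, hb⟩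
      · rw [hn2 ξ hn]
        exact Or.inl ⟨hleaf ξ hξ, hn⟩
    · intro p hp
      rw [hnew] at hp
      rcases hp with ⟨hp, hpv⟩ | ⟨b, rfl, ξ, hξ, hb⟩
      · obtain ⟨ξ, hξ, rfl⟩ := h.inhabited p ((isLeafOpt_some _ _).mpr hp)
        exact ⟨ξ, hξ, (hn2 ξ hpv).symm⟩
      · exact ⟨ξ, hξ, (hn1 ξ hξ b hb).symm⟩

lemma expandLeaf_cost {a d k : ℕ} (ha : 1 ≤ a) (hd : 1 ≤ d) (x : Idx a d → ℂ)
    (chi : List (Entry a d)) (T : SplitTree) (v : Path) (Δs : List (Idx a d))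
    (hrow : RowsCorrect Δs chi) (hv : IsLeaf T v) (hvl : v.length < d * a)
    (hS : d * a ≤ Δs.length) (hk : chi.length ≤ k) (hk1 : 1 ≤ k) (hw : 2 ^ weight T v ≤ k) :
    (expandLeaf x Δs T chi v).samples ≤ 4 * (k * Δs.length) ∧
      (expandLeaf x Δs T chi v).steps ≤ 260 * (k * Δs.length) := by
  have hz : ∀ b, _ := fun b => zeroTest_cost (k := k) ha hd x chi
    (graft (.two .leaf .leaf) T v).val (v ++ [b]) Δs hrow
    ((isLeaf_graft _ _ _ hv _).mpr (Or.inr ⟨[b], rfl, by cases b <;> rfl⟩)) (by simpa using hvl)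
    hS hk hk1 (by rw [weight_graft_two T v hv, pow_succ]; omega)
  have hzf := hz false
  have hzt := hz true
  obtain ⟨-, hsam, hste⟩ := expandLeaf_run x Δs T chi v
  have hg : ∀ b c, (addChildren T v b c).samples = 0 ∧
      (addChildren T v b c).steps ≤ 2 * v.length + 1 := by
    rintro (_ | _) (_ | _)
    · simp [addChildren]
    all_goals exact ⟨graft_samples _ _ _, graft_steps _ _ _⟩
  have hg' := hg (zeroTest x chi (graft (.two .leaf .leaf) T v).val (v ++ [false]) Δs).val
    (zeroTest x chi (graft (.two .leaf .leaf) T v).val (v ++ [true]) Δs).val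
  dsimp only at hsam hste
  rw [graft_samples] at hsam
  have hgr := graft_steps (.two .leaf .leaf) T v
  have hkS : Δs.length ≤ k * Δs.length := Nat.le_mul_of_pos_left _ hk1
  have hL : 1 ≤ d * a := Nat.mul_pos hd ha
  omega

/-- Amortized form: each unrecovered frequency holds a credit of `Δs.length * (2 * d + 4)` steps,
which is spent on its phase table when it leaves `R`. -/
lemma iteration_inv {a d k : ℕ} {x : Idx a d → ℂ} {Δs : List (Idx a d)} {T : SplitTree}
    {chi : List (Entry a d)} {R : Finset (Idx a d)} {dep : Idx a d → ℕ} (ha : 1 ≤ a) (hd : 1 ≤ d)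
    (hgen : Generic x Δs) (hS : d * a ≤ Δs.length)
    (h : LoopInv x Δs k (some T) chi R dep) :
    ∃ R' dep', LoopInv x Δs k (iteration x Δs T chi).val.1 (iteration x Δs T chi).val.2 R' dep' ∧
      potential R' dep' < potential R dep ∧
      (iteration x Δs T chi).samples ≤ 4 * (k * Δs.length) ∧
      (iteration x Δs T chi).steps + R'.card * (Δs.length * (2 * d + 4))
        ≤ 280 * (k * Δs.length) + R.card * (Δs.length * (2 * d + 4)) := by
  set v := (minLeaf T).val.1 with hvdef
  have hv : IsLeaf T v := isLeaf_minLeaf T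
  have hL : 1 ≤ d * a := Nat.mul_pos hd ha
  have hΔ : Δs ≠ [] := List.length_pos_iff.mp (by omega)
  have hleafdepth : ∀ p, IsLeaf T p → p.length ≤ d * a := by
    intro p hp
    obtain ⟨ξ, hξ, rfl⟩ := h.inhabited p ((isLeafOpt_some _ _).mpr hp)
    rw [length_node (h.depth_le ξ hξ)]
    exact h.depth_le ξ hξ
  have hvl := hleafdepth v hv
  have hleaves : (leaves T).length ≤ R.card := length_leaves_le_card T R (node dep) fun p hp =>
    h.inhabited p ((isLeafOpt_some _ _).mpr hp)
  have hcard := h.card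
  have hk1 : 1 ≤ k := by have := length_leaves_pos T; omega
  -- Minimality of the weight enters here: `2 ^ weight ≤` number of leaves `≤ R.card ≤ k`.
  have hw : 2 ^ weight T v ≤ k := by
    have := two_pow_minLeaf_le T
    rw [minLeaf_weight, ← hvdef] at this
    omega
  have hmin := minLeaf_steps T (d * a) hleafdepth
  have hmin' : (leaves T).length * (4 * (d * a + 1)) ≤ 8 * (k * Δs.length) := by
    calc (leaves T).length * (4 * (d * a + 1)) ≤ k * (8 * Δs.length) :=
          Nat.mul_le_mul (by omega) (by omega)
      _ = _ := by ring
  have hkS : Δs.length ≤ k * Δs.length := Nat.le_mul_of_pos_left _ hk1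
  have hrl := readLabel_steps v
  set g := if (readLabel v).val.2 = d * a then estimateLeaf x Δs T chi v
    else expandLeaf x Δs T chi v with hg
  have hval : (iteration x Δs T chi).val = g.val := rfl
  have hsam : (iteration x Δs T chi).samples = (minLeaf T).samples + ((readLabel v).samples +
    (0 + g.samples)) := rfl
  have hste : (iteration x Δs T chi).steps = (minLeaf T).steps + ((readLabel v).steps +
    (2 + g.steps)) := rfl
  rw [minLeaf_samples, readLabel_samples] at hsam
  rw [readLabel_level] at hg
  rw [hval, hsam, hste]
  by_cases hfull : v.length = d * a
  · rw [if_pos hfull] at hg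
    rw [hg]
    obtain ⟨hmem, hdep, hinv⟩ := estimateLeaf_inv h v hv hfull
    have hcost := estimateLeaf_cost (k := k) ha hd x chi T v Δs hv hvl hS (by omega) hk1 hw
    refine ⟨_, dep, hinv, ?_, by omega, ?_⟩
    -- A frequency at depth `d * a` still contributes `1` to the potential, which is the decrease in
    -- this case.
    · have := Finset.sum_erase_add R (fun ξ => d * a + 1 - dep ξ) hmem
      simp only [potential]
      rw [hdep] at this
      omega
    · rw [← Finset.card_erase_add_one hmem, add_mul]
      omega
  · rw [if_neg hfull] at hg
    rw [hg]
    have hlt : v.length < d * a := by omega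
    obtain ⟨dep', hpot, hinv⟩ := expandLeaf_inv hgen hΔ h v hv hlt
    have hcost := expandLeaf_cost (k := k) ha hd x chi T v Δs h.rows hv hlt hS (by omega) hk1 hw
    exact ⟨R, dep', hinv, hpot, by omega, by omega⟩

/-- Induction on a bound for the potential. The loop makes one check of its condition more than it
makes iterations, hence `m + 1`. -/
lemma mainLoop_spec {a d k : ℕ} {x : Idx a d → ℂ} {Δs : List (Idx a d)} (ha : 1 ≤ a) (hd : 1 ≤ d)
    (hgen : Generic x Δs) (hS : d * a ≤ Δs.length) (m : ℕ) (T : Option SplitTree)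
    (chi : List (Entry a d)) (R : Finset (Idx a d)) (dep : Idx a d → ℕ)
    (h : LoopInv x Δs k T chi R dep) (hm : potential R dep ≤ m) :
    ∃ r, mainLoop x Δs (m + 1) T chi = some r ∧ (∀ f, spectrum r.val f = dft x f) ∧
      r.samples ≤ m * (4 * (k * Δs.length)) ∧
      r.steps ≤ m * (280 * (k * Δs.length) + 1) + R.card * (Δs.length * (2 * d + 4)) + 1 := by
  induction m generalizing T chi R dep with
  | zero =>
    rcases T with _ | T
    · refine ⟨charge 1 chi, rfl, fun f => h.recovered.not_mem f fun hf => ?_, by simp, by simp⟩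
      obtain ⟨t, ht, _⟩ := h.covered f hf
      simp at ht
    -- A nonempty tree has a leaf, hence an unrecovered frequency, and that one contributes at least
    -- `1` to a potential assumed to be zero.
    · obtain ⟨ξ, hξ, _⟩ := h.inhabited _ ((isLeafOpt_some _ _).mpr (isLeaf_minLeaf T))
      have h1 := Finset.single_le_sum (f := fun ξ => d * a + 1 - dep ξ)
        (fun _ _ => Nat.zero_le _) hξ
      have h2 := h.depth_le ξ hξ
      simp only [potential] at hm
      omega
  | succ m ih =>
    rcases T with _ | T
    · refine ⟨charge 1 chi, rfl, fun f => h.recovered.not_mem f fun hf => ?_, by simp, by simp⟩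
      obtain ⟨t, ht, _⟩ := h.covered f hf
      simp at ht
    · obtain ⟨R', dep', hinv, hpot, hsam, hste⟩ := iteration_inv ha hd hgen hS h
      obtain ⟨r, hr, hspec, hs, ht⟩ := ih _ _ R' dep' hinv (by omega)
      refine ⟨⟨r.val, (iteration x Δs T chi).samples + r.samples,
        (iteration x Δs T chi).steps + r.steps + 1⟩, ?_, hspec, ?_, ?_⟩
      · rw [mainLoop]
        simp only [hr, Option.map_some]
      · dsimp only
        rw [add_mul]
        omega
      · dsimp only
        rw [add_mul m 1]
        omega

/-- On a signal with generic spectrum the algorithm is correct and efficient. -/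
lemma sparseFFT_of_generic {a d k s : ℕ} (ha : 1 ≤ a) (hd : 1 ≤ d) (hk : 1 ≤ k)
    (x : Idx a d → ℂ) (Δ : Fin s → Idx a d) (hs : d * a ≤ s) (hgen : Generic x (List.ofFn Δ))
    (hcard : {f | dft x f ≠ 0}.ncard = k) :
    ∃ r, SparseFFTRandomPhase x Δ r ∧ (∀ f, spectrum r.val f = dft x f) ∧
      r.samples ≤ 8 * (k ^ 2 * (d * a) * s) ∧
      r.steps ≤ 600 * (k ^ 2 * (d * a) * s) + 10 * (k * d * s) := by
  classical
  set R : Finset (Idx a d) := Finset.univ.filter fun f => dft x f ≠ 0 with hR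
  have hRk : R.card = k := by
    rw [← hcard, ← Set.ncard_coe_finset]; congr 1; ext f; simp [hR]
  have hne : R.Nonempty := Finset.card_pos.mp (by omega)
  have hinv : LoopInv x (List.ofFn Δ) k (some .leaf) [] R (fun _ => 0) := by
    refine ⟨⟨by simp [hR], by simp [spectrum], ?_⟩, ?_, by simp [hRk], by simp, ?_, ?_⟩
    · intro ξ hξ
      have : dft x ξ = 0 := by simpa [hR] using hξ
      simp [spectrum, this]
    · intro e he; simp at he
    · intro ξ _
      rw [isLeafOpt_some]; simp [node, IsLeaf]
    · intro p hp
      rw [isLeafOpt_some] at hp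
      obtain ⟨ξ, hξ⟩ := hne
      exact ⟨ξ, hξ, by simpa [node, IsLeaf] using hp⟩
  have hpot : potential R (fun _ => 0) = k * (d * a + 1) := by
    simp [potential, hRk]
  obtain ⟨r, hr, hspec, hsam, hste⟩ := mainLoop_spec ha hd hgen (by simpa using hs)
    (k * (d * a + 1)) _ _ R _ hinv hpot.le
  rw [List.length_ofFn] at hsam hste
  rw [hRk] at hste
  have hL : 1 ≤ d * a := Nat.mul_pos hd ha
  -- The potential at the start is `k (log₂ N + 1)`; since `log₂ N ≥ 1`, the additional `k` costs at
  -- most a factor two.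
  have h2 : k * (d * a + 1) ≤ 2 * (k * (d * a)) := by
    have : k * (d * a + 1) = k * (d * a) + k := by ring
    have : k ≤ k * (d * a) := Nat.le_mul_of_pos_right _ hL
    omega
  refine ⟨⟨r.val, r.samples, r.steps + s * (d + 1) + 1⟩, ⟨_, r, hr, rfl⟩, hspec, ?_, ?_⟩
  · calc r.samples ≤ k * (d * a + 1) * (4 * (k * s)) := hsam
      _ ≤ 2 * (k * (d * a)) * (4 * (k * s)) := Nat.mul_le_mul_right _ h2
      _ = _ := by ring
  · have e1 : k * (d * a + 1) * (280 * (k * s) + 1) ≤ 562 * (k ^ 2 * (d * a) * s) := by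
      have : 1 ≤ k * s := Nat.mul_pos hk (by omega)
      calc k * (d * a + 1) * (280 * (k * s) + 1) ≤ 2 * (k * (d * a)) * (281 * (k * s)) :=
            Nat.mul_le_mul h2 (by omega)
        _ = _ := by ring
    have e2 : k * (s * (2 * d + 4)) ≤ 6 * (k * d * s) := by
      calc k * (s * (2 * d + 4)) ≤ k * (s * (6 * d)) := by gcongr; omega
        _ = _ := by ring
    have e3 : s * (d + 1) ≤ 2 * (k * d * s) := by
      calc s * (d + 1) ≤ k * (s * (2 * d)) := by
            refine le_trans ?_ (Nat.le_mul_of_pos_left _ hk)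
            gcongr; omega
        _ = _ := by ring
    have e4 : 1 ≤ k * d * s := Nat.mul_pos (Nat.mul_pos hk hd) (by omega)
    dsimp only
    omega

/-! ## Random phases -/

section Random
open MeasureTheory ProbabilityTheory

/-- Any two solutions differ by a multiple of `2π`, so the solution set is countable. -/
lemma volume_phase_eq_zero {c : ℂ} (hc : c ≠ 0) (w : ℂ) :
    volume {u : ℝ | w + c * Complex.exp (Complex.I * u) = 0} = 0 := by
  refine Set.Countable.measure_zero ?_ _
  by_cases hne : ∃ u₀ : ℝ, w + c * Complex.exp (Complex.I * u₀) = 0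
  · obtain ⟨u₀, h₀⟩ := hne
    refine (Set.countable_range fun n : ℤ => u₀ + n * (2 * Real.pi)).mono fun u hu => ?_
    have he : Complex.exp (Complex.I * u) = Complex.exp (Complex.I * u₀) :=
      mul_left_cancel₀ hc (add_left_cancel (Eq.trans hu h₀.symm))
    obtain ⟨n, hn⟩ := Complex.exp_eq_exp_iff_exists_int.mp he
    refine ⟨n, ?_⟩
    have : Complex.I * (u : ℂ) = Complex.I * ((u₀ + n * (2 * Real.pi) : ℝ) : ℂ) := by
      rw [hn]; push_cast; ring
    exact_mod_cast (mul_left_cancel₀ Complex.I_ne_zero this).symm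
  · rw [Set.eq_empty_of_forall_notMem (fun u hu => hne ⟨u, hu⟩)]
    exact Set.countable_empty

/-- One index `f₀` is singled out. The rest `W` of the sum is independent of `θ f₀`, the joint law
is a product, and for each fixed value of `W` the bad phases form a null set. -/
lemma ae_phase_sum_ne_zero {Ω ι : Type*} [MeasurableSpace Ω] {P : Measure Ω}
    [IsProbabilityMeasure P] {θ : ι → Ω → ℝ} (hmeas : ∀ f, Measurable (θ f))
    (hac : ∀ f, P.map (θ f) ≪ volume) (hind : iIndepFun θ P) (S : Finset ι) (hS : S.Nonempty)
    (c : ι → ℂ) (hc : ∀ f ∈ S, c f ≠ 0) :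
    ∀ᵐ ω ∂P, ∑ f ∈ S, c f * Complex.exp (Complex.I * θ f ω) ≠ 0 := by
  classical
  obtain ⟨f₀, hf₀⟩ := hS
  set W : Ω → ℂ := fun ω => ∑ f ∈ S.erase f₀, c f * Complex.exp (Complex.I * θ f ω) with hW
  have hWm : Measurable W := by
    refine Finset.measurable_sum _ fun f _ => ?_
    have := hmeas f
    fun_prop
  have hpair : IndepFun W (θ f₀) P := by
    have h := hind.indepFun_finset (S.erase f₀) {f₀} (by simp) hmeas
    have h1 : W = (fun y : (S.erase f₀) → ℝ =>
        ∑ f : S.erase f₀, c f * Complex.exp (Complex.I * y f)) ∘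
        (fun ω (i : S.erase f₀) => θ i ω) := by
      funext ω
      simp only [hW, Function.comp]
      exact (Finset.sum_coe_sort (S.erase f₀)
        fun f => c f * Complex.exp (Complex.I * θ f ω)).symm
    have h2 : θ f₀ = (fun y : ({f₀} : Finset ι) → ℝ => y ⟨f₀, Finset.mem_singleton_self f₀⟩) ∘
        (fun ω (i : ({f₀} : Finset ι)) => θ i ω) := rfl
    rw [h1, h2]
    refine h.comp ?_ (measurable_pi_apply _)
    fun_prop
  have hlaw := (indepFun_iff_map_prod_eq_prod_map_map hWm.aemeasurable
    (hmeas f₀).aemeasurable).mp hpair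
  set B : Set (ℂ × ℝ) := {p | p.1 + c f₀ * Complex.exp (Complex.I * p.2) = 0} with hB
  have hBm : MeasurableSet B := measurableSet_eq_fun (by fun_prop) measurable_const
  have : IsProbabilityMeasure (P.map (θ f₀)) :=
    Measure.isProbabilityMeasure_map (hmeas f₀).aemeasurable
  have hnull : (P.map W).prod (P.map (θ f₀)) B = 0 := by
    refine Measure.measure_prod_null_of_ae_null hBm (Filter.Eventually.of_forall fun w => ?_)
    exact hac f₀ (volume_phase_eq_zero (hc f₀ hf₀) w)
  rw [← hlaw, Measure.map_apply (hWm.prodMk (hmeas f₀)) hBm] at hnull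
  rw [ae_iff]
  refine measure_mono_null (fun ω hω => ?_) hnull
  simp only [ne_eq, not_not, Set.mem_ofPred_eq] at hω
  rw [← Finset.sum_erase_add S _ hf₀] at hω
  exact hω

/-- Only finitely many pairs `(S, t)` occur, so the exceptional null sets can be united. As `t` runs
over all of `[n]^d`, one null set serves all lists of sample points. The character values are
absorbed into the coefficients. -/
lemma ae_generic {Ω : Type*} [MeasurableSpace Ω] {P : Measure Ω} [IsProbabilityMeasure P]
    {a d : ℕ} {X : Ω → Idx a d → ℂ} {β : Idx a d → ℂ} (hX : IsRandomPhaseSignal P X β) :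
    ∀ᵐ ω ∂P, ∀ Δs, Generic (X ω) Δs := by
  obtain ⟨θ, hmeas, hunif, hind, hdft⟩ := hX
  have hz : ∀ ω f, dft (X ω) f ≠ 0 ↔ β f ≠ 0 := fun ω f => by
    rw [hdft]; simp [Complex.exp_ne_zero]
  have hchr : ∀ f t : Idx a d, chr f t ≠ 0 := fun f t => by
    rw [← ex_dot]; exact ex_ne_zero _
  have h : ∀ᵐ ω ∂P, ∀ (S : Finset (Idx a d)) (t : Idx a d), S.Nonempty → (∀ f ∈ S, β f ≠ 0) →
      ∑ f ∈ S, β f * chr f t * Complex.exp (Complex.I * θ f ω) ≠ 0 := by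
    rw [ae_all_iff]; intro S
    rw [ae_all_iff]; intro t
    by_cases hS : S.Nonempty ∧ ∀ f ∈ S, β f ≠ 0
    · filter_upwards [ae_phase_sum_ne_zero hmeas (fun f => (hunif f).absolutelyContinuous) hind S
        hS.1 (fun f => β f * chr f t) fun f hf => mul_ne_zero (hS.2 f hf) (hchr f t)] with ω hω
      exact fun _ _ => hω
    · exact Filter.Eventually.of_forall fun ω h1 h2 => absurd ⟨h1, h2⟩ hS
  filter_upwards [h] with ω hω Δs S hS hSβ t _
  have := hω S t hS fun f hf => (hz ω f).mp (hSβ f hf)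
  simp only [hdft]
  convert this using 2
  ring

end Random

end SFFT

/-! ### The main theorem -/

theorem theorem2p6 :
    ∃ C₀ : ℕ, ∀ C : ℕ, C₀ ≤ C → ∃ A : ℝ,
      ∀ (a d k : ℕ), 1 ≤ a → 1 ≤ d → 1 ≤ k →
      ∀ (Ω : Type*) [MeasurableSpace Ω] (P : MeasureTheory.Measure Ω)
        [MeasureTheory.IsProbabilityMeasure P]
        (β : SFFT.Idx a d → ℂ) (X : Ω → SFFT.Idx a d → ℂ)
        (Δ : Fin (SFFT.sampleCount C a d) → Ω → SFFT.Idx a d),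
        {f | β f ≠ 0}.ncard = k →
        SFFT.IsRandomPhaseSignal P X β →
        SFFT.IsUniformSample P Δ →
        ProbabilityTheory.IndepFun X (fun ω i => Δ i ω) P →
        -- the failure probability is at most `1 / N ^ 2`
        P {ω | ¬ ∃ r, SFFT.SparseFFTRandomPhase (X ω) (fun i => Δ i ω) r ∧
            ∀ f, SFFT.spectrum r.val f = SFFT.dft (X ω) f}
          ≤ ENNReal.ofReal (1 / (((2 : ℝ) ^ a) ^ d) ^ 2) ∧
        -- the sample complexity and the runtime
        ∀ᵐ ω ∂P, ∃ r, SFFT.SparseFFTRandomPhase (X ω) (fun i => Δ i ω) r ∧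
          (r.samples : ℝ) ≤ A * (k : ℝ) ^ 2 * Real.logb 2 (((2 : ℝ) ^ a) ^ d) ^ 4 ∧
          (r.steps : ℝ) ≤ A * (k : ℝ) ^ 2 * Real.logb 2 (((2 : ℝ) ^ a) ^ d) ^ 4 := by
  -- The constant is `610 = 600 + 10`, the two step terms of `sparseFFT_of_generic` combined. The
  -- condition `C ≥ 1` is what gives `log₂ N ≤ s`.
  refine ⟨1, fun C hC => ⟨610 * C, ?_⟩⟩
  intro a d k ha hd hk Ω _ P _ β X Δ hβ hX _ _
  have hlog : Real.logb 2 (((2 : ℝ) ^ a) ^ d) = ((d * a : ℕ) : ℝ) := by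
    rw [← pow_mul, Real.logb_pow, Real.logb_self_eq_one (by norm_num), mul_one, mul_comm]
  have hL : 1 ≤ d * a := Nat.mul_pos hd ha
  have hs : SFFT.sampleCount C a d = C * (d * a) ^ 3 := by rw [SFFT.sampleCount]; ring
  have hle : d * a ≤ SFFT.sampleCount C a d := by
    rw [hs]
    calc d * a ≤ (d * a) ^ 3 := Nat.le_self_pow (by norm_num) _
      _ ≤ _ := Nat.le_mul_of_pos_left _ hC
  have hsupp : ∀ ω, {f | SFFT.dft (X ω) f ≠ 0}.ncard = k := by
    obtain ⟨θ, -, -, -, hdft⟩ := hX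
    intro ω
    rw [← hβ]
    congr 1
    ext f
    simp [hdft, Complex.exp_ne_zero]
  have hmain : ∀ᵐ ω ∂P, ∃ r, SFFT.SparseFFTRandomPhase (X ω) (fun i => Δ i ω) r ∧
      (∀ f, SFFT.spectrum r.val f = SFFT.dft (X ω) f) ∧
      r.samples ≤ 610 * C * k ^ 2 * (d * a) ^ 4 ∧ r.steps ≤ 610 * C * k ^ 2 * (d * a) ^ 4 := by
    filter_upwards [SFFT.ae_generic hX] with ω hω
    obtain ⟨r, hr, hspec, hsam, hste⟩ :=
      SFFT.sparseFFT_of_generic ha hd hk (X ω) (fun i => Δ i ω) hle (hω _) (hsupp ω)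
    have e : k ^ 2 * (d * a) * SFFT.sampleCount C a d = C * k ^ 2 * (d * a) ^ 4 := by
      rw [hs]; ring
    have e' : k * d * SFFT.sampleCount C a d ≤ C * k ^ 2 * (d * a) ^ 4 := by
      rw [← e]
      gcongr
      · exact Nat.le_self_pow (by norm_num) _
      · exact Nat.le_mul_of_pos_right _ ha
    rw [e] at hsam hste
    refine ⟨r, hr, hspec, ?_, ?_⟩
    · calc r.samples ≤ 8 * (C * k ^ 2 * (d * a) ^ 4) := hsam
        _ ≤ 610 * (C * k ^ 2 * (d * a) ^ 4) := by gcongr; norm_num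
        _ = _ := by ring
    · calc r.steps ≤ 610 * (C * k ^ 2 * (d * a) ^ 4) := by omega
        _ = _ := by ring
  constructor
  -- The failure event is contained in the null set where genericity fails.
  · refine le_of_eq_of_le ?_ zero_le
    refine MeasureTheory.measure_mono_null (fun ω hω => ?_) (MeasureTheory.ae_iff.mp hmain)
    rintro ⟨r, hr, hspec, -⟩
    exact hω ⟨r, hr, hspec⟩
  · filter_upwards [hmain] with ω hω
    obtain ⟨r, hr, -, hsam, hste⟩ := hω
    rw [hlog]
    exact ⟨r, hr, by exact_mod_cast hsam, by exact_mod_cast hste⟩
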